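/- Let $A$ be a unital ring and $\mathsf M_A$ the category of right $A$-modules. A \emph{bialgebroid structure} on $A$ consists of a ring $R$, ring homomorphisms $s\colon R\to A$ and $t\colon R^{op}\to A$ with commuting images, so that every right $A$-module $V$ is an $R$-$R$-bimodule by $r\cdot v=v\,t(r)$, $v\cdot r=v\,s(r)$, and an (additive) monoidal structure on $\mathsf M_A$ for which the forgetful functor $\phi_R\colon\mathsf M_A\to{}_R\mathsf M_R$ is strictly monoidal. Two bialgebroid structures are identified if there is a ring isomorphism $f\colon R\to R'$ with $s'f=s$, $t'f=t$ such that $f\colon R\to R'$ and the maps $V\otimes_R W\to V\otimes_{R'}W$, $v\otimes w\mapsto v\otimes w$, form an isomorphism between the two monoidal structures. A \emph{categorical datum} on $A$ consists of (i) a monoidal structure $\langle\mathsf M_A,\otimes,U\rangle$ on the category of right $A$-modules, with $\otimes$ additive in each variable. Put $Z=\mathrm{End}(U)$; every right $A$-module $V$ is a $Z$-$Z$-bimodule, $z\in Z$ acting from the left by $V\cong U\otimes V\xrightarrow{z\otimes V}U\otimes V\cong V$ and from the right by $V\cong V\otimes U\xrightarrow{V\otimes z}V\otimes U\cong V$, which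 gives the forgetful functor $\phi_Z\colon\mathsf M_A\to{}_Z\mathsf M_Z$; (ii) a (lax) monoidal structure $\langle\phi_Z,\mu,\zeta\rangle$ on $\phi_Z$, with $\mu_{V,W}\colon V\otimes_Z W\to V\otimes W$ and $\zeta\colon Z\to U$, such that for all $V,W$ the sequence $$V\otimes_Z(U\otimes_Z W)\;\rightrightarrows\;V\otimes_Z W\xrightarrow{\ \mu_{V,W}\ }V\otimes W\to 0$$ is exact, i.e. $\mu_{V,W}$ is surjective and its kernel is the image of the difference of the two arrows. The two arrows are $V\otimes_Z\lambda_W$, and $\rho_V\otimes_Z W$ preceded by the canonical isomorphism $V\otimes_Z(U\otimes_Z W)\cong(V\otimes_Z U)\otimes_Z W$, where $\lambda_W\colon U\otimes_Z W\xrightarrow{\mu}U\otimes W\cong W$ and $\rho_V\colon V\otimes_Z U\xrightarrow{\mu}V\otimes U\cong V$. Two categorical data are identified if the identity functor of $\mathsf M_A$ carries a strong monoidal structure between the two monoidal structures that is compatible with $\mu$ and $\zeta$. \textbf{Theorem.} For every ring $A$ there is a bijection $\Phi$ from the set of classes of bialgebroid structures on $A$ to the set of classes of categorical data on $A$ such that: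 (a) $\Phi$ sends a bialgebroid structure to the class of the datum with the same monoidal structure on $\mathsf M_A$, with $\mu_{V,W}(v\otimes_Z w)=v\otimes_R w$, and with $\zeta\colon Z\to R$ the inclusion $\zeta(z)=z(1_R)$ (here $U=R$ as an additive group); (b) if $\Phi$ sends the class of $\langle R,s,t,\otimes\rangle$ to the class of $\langle\otimes,U,\mu,\zeta\rangle$, then $R$ is, up to an isomorphism of additive groups $R\cong U$, the group $U$ with the multiplication $U\otimes_Z U\xrightarrow{\mu_{U,U}}U\otimes U\cong U$ and the unit $\zeta(1)$, and under this isomorphism $v\,t(r)=\lambda_V(r\otimes_Z v)$ and $v\,s(r)=\rho_V(v\otimes_Z r)$ for every right $A$-module $V$, $v\in V$ and $r\in R$. -/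

import Mathlib

open CategoryTheory MonoidalCategory MulOpposite

universe u

/-! ### The tensor product over a (not necessarily commutative) ring -/

section BalancedTensor

variable (R : Type u) [Ring R]

/-- The subgroup of `V ⊗_ℤ W` generated by the elements `(v · r) ⊗ w - v ⊗ (r · w)`. -/
def BalTensor.relations (V W : Type u) [AddCommGroup V] [AddCommGroup W]
    [Module Rᵐᵒᵖ V] [Module R W] : AddSubgroup (TensorProduct ℤ V W) :=
  AddSubgroup.closure
    {x | ∃ (v : V) (r : R) (w : W),
      x = TensorProduct.tmul ℤ (op r • v) w - TensorProduct.tmul ℤ v (r • w)}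

/-- The tensor product `V ⊗_R W` of a right `R`-module `V` and a left `R`-module `W`. -/
def BalTensor (V W : Type u) [AddCommGroup V] [AddCommGroup W]
    [Module Rᵐᵒᵖ V] [Module R W] : Type u :=
  TensorProduct ℤ V W ⧸ BalTensor.relations R V W

namespace BalTensor

variable {V W X V' W' : Type u} [AddCommGroup V] [AddCommGroup W] [AddCommGroup X]
  [AddCommGroup V'] [AddCommGroup W']

noncomputable instance [Module Rᵐᵒᵖ V] [Module R W] : AddCommGroup (BalTensor R V W) :=
  inferInstanceAs (AddCommGroup (TensorProduct ℤ V W ⧸ BalTensor.relations R V W))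

section

variable [Module Rᵐᵒᵖ V] [Module R W] [Module Rᵐᵒᵖ V'] [Module R W']

/-- The class `v ⊗_R w` of a pure tensor. -/
noncomputable def tmul (v : V) (w : W) : BalTensor R V W :=
  QuotientAddGroup.mk' (BalTensor.relations R V W) (TensorProduct.tmul ℤ v w)

theorem add_tmul (v v' : V) (w : W) : tmul R (v + v') w = tmul R v w + tmul R v' w := by
  simp only [tmul, TensorProduct.add_tmul]; exact map_add _ _ _

theorem tmul_add (v : V) (w w' : W) : tmul R v (w + w') = tmul R v w + tmul R v w' := by
  simp only [tmul, TensorProduct.tmul_add]; exact map_add _ _ _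

theorem smul_tmul (v : V) (r : R) (w : W) : tmul R (op r • v) w = tmul R v (r • w) := by
  refine (QuotientAddGroup.eq_iff_sub_mem (N := BalTensor.relations R V W)).2 ?_
  exact AddSubgroup.subset_closure ⟨v, r, w, rfl⟩

@[elab_as_elim]
theorem induction_on {P : BalTensor R V W → Prop} (x : BalTensor R V W) (zero : P 0)
    (pure : ∀ v w, P (tmul R v w)) (add : ∀ x y, P x → P y → P (x + y)) : P x := by
  obtain ⟨y, rfl⟩ := QuotientAddGroup.mk'_surjective _ x
  induction y using TensorProduct.induction_on with
  | zero => rw [map_zero]; exact zero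
  | tmul v w => exact pure v w
  | add a b ha hb => rw [map_add]; exact add _ _ ha hb

variable (V W) in
/-- The biadditive map `(v, w) ↦ v ⊗ w`. -/
noncomputable def tmulHom : V →+ W →+ BalTensor R V W :=
  AddMonoidHom.mk' (fun v => AddMonoidHom.mk' (tmul R v) (tmul_add R v))
    (fun v v' => by ext w; simp [add_tmul])

@[simp]
theorem tmulHom_apply (v : V) (w : W) : tmulHom R V W v w = tmul R v w := rfl

@[simp]
theorem zero_tmul (w : W) : tmul R (0 : V) w = 0 := by
  simpa using add_tmul R (0 : V) 0 w

@[simp]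
theorem tmul_zero (v : V) : tmul R v (0 : W) = 0 := by
  simpa using tmul_add R v (0 : W) 0

variable {R} in
/-- A balanced biadditive map out of `V × W` induces an additive map out of `V ⊗_R W`. -/
noncomputable def lift (f : V →+ W →+ X) (h : ∀ v (r : R) w, f (op r • v) w = f v (r • w)) :
    BalTensor R V W →+ X :=
  QuotientAddGroup.lift (BalTensor.relations R V W)
    (TensorProduct.liftAddHom f (fun n v w => by simp)) (by
      unfold BalTensor.relations
      rw [AddSubgroup.closure_le]
      rintro _ ⟨v, r, w, rfl⟩
      simp [h])

variable {R} in
@[simp]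
theorem lift_tmul (f : V →+ W →+ X) (h : ∀ v (r : R) w, f (op r • v) w = f v (r • w))
    (v : V) (w : W) : lift f h (tmul R v w) = f v w := rfl

variable {R} in
theorem hom_ext {f g : BalTensor R V W →+ X} (h : ∀ v w, f (tmul R v w) = g (tmul R v w)) :
    f = g := by
  ext x
  induction x using induction_on with
  | zero => simp
  | pure v w => exact h v w
  | add x y hx hy => simp [hx, hy]

variable {R} in
/-- The additive map `v ⊗ w ↦ f v ⊗ g w`. -/
noncomputable def map (f : V →+ V') (g : W →+ W') (hf : ∀ (r : R) v, f (op r • v) = op r • f v)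
    (hg : ∀ (r : R) w, g (r • w) = r • g w) : BalTensor R V W →+ BalTensor R V' W' :=
  lift (((tmulHom R V' W').comp f).compl₂ g)
    (fun v r w => by simp [hf, hg, smul_tmul])

variable {R} in
@[simp]
theorem map_tmul (f : V →+ V') (g : W →+ W') (hf : ∀ (r : R) v, f (op r • v) = op r • f v)
    (hg : ∀ (r : R) w, g (r • w) = r • g w) (v : V) (w : W) :
    map f g hf hg (tmul R v w) = tmul R (f v) (g w) := rfl

end

section

variable [Module R V] [Module Rᵐᵒᵖ V] [SMulCommClass R Rᵐᵒᵖ V] [Module R W]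

/-- The map `v ⊗ w ↦ (r · v) ⊗ w`. -/
noncomputable def leftMul (r : R) : BalTensor R V W →+ BalTensor R V W :=
  map (DistribSMul.toAddMonoidHom V r) (AddMonoidHom.id W)
    (fun r' v => by simpa using smul_comm r (op r') v) (fun _ _ => by simp)

variable {R} in
@[simp]
theorem leftMul_tmul (r : R) (v : V) (w : W) : leftMul R r (tmul R v w) = tmul R (r • v) w := rfl

/-- The left action `r · (v ⊗ w) = (r · v) ⊗ w`, when `V` is a bimodule. -/
noncomputable instance : Module R (BalTensor R V W) where
  smul r x := leftMul R r x
  one_smul x := DFunLike.congr_fun (f := leftMul R 1) (g := AddMonoidHom.id _)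
    (hom_ext fun v w => by simp) x
  mul_smul r r' x := DFunLike.congr_fun (f := leftMul R (r * r'))
    (g := (leftMul R r).comp (leftMul R r')) (hom_ext fun v w => by simp [mul_smul]) x
  smul_zero r := map_zero (leftMul R r)
  smul_add r x y := map_add (leftMul R r) x y
  add_smul r r' x := DFunLike.congr_fun (f := leftMul R (r + r')) (g := leftMul R r + leftMul R r')
    (hom_ext fun v w => by simp [add_smul, add_tmul]) x
  zero_smul x := DFunLike.congr_fun (f := leftMul R 0) (g := 0)
    (hom_ext fun v w => by simp) x

@[simp]
theorem left_smul_tmul (r : R) (v : V) (w : W) : r • tmul R v w = tmul R (r • v) w := rfl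

end

section

variable [Module Rᵐᵒᵖ V] [Module R W] [Module Rᵐᵒᵖ W] [SMulCommClass R Rᵐᵒᵖ W]

/-- The map `v ⊗ w ↦ v ⊗ (w · r)`. -/
noncomputable def rightMul (r : Rᵐᵒᵖ) : BalTensor R V W →+ BalTensor R V W :=
  map (AddMonoidHom.id V) (DistribSMul.toAddMonoidHom W r)
    (fun _ _ => by simp) (fun r' w => by simpa using (smul_comm r' r w).symm)

variable {R} in
@[simp]
theorem rightMul_tmul (r : Rᵐᵒᵖ) (v : V) (w : W) :
    rightMul R r (tmul R v w) = tmul R v (r • w) := rfl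

/-- The right action `(v ⊗ w) · r = v ⊗ (w · r)`, when `W` is a bimodule. -/
noncomputable instance : Module Rᵐᵒᵖ (BalTensor R V W) where
  smul r x := rightMul R r x
  one_smul x := DFunLike.congr_fun (f := rightMul R 1) (g := AddMonoidHom.id _)
    (hom_ext fun v w => by simp) x
  mul_smul r r' x := DFunLike.congr_fun (f := rightMul R (r * r'))
    (g := (rightMul R r).comp (rightMul R r')) (hom_ext fun v w => by simp [mul_smul]) x
  smul_zero r := map_zero (rightMul R r)
  smul_add r x y := map_add (rightMul R r) x y
  add_smul r r' x := DFunLike.congr_fun (f := rightMul R (r + r'))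
    (g := rightMul R r + rightMul R r') (hom_ext fun v w => by simp [add_smul, tmul_add]) x
  zero_smul x := DFunLike.congr_fun (f := rightMul R 0) (g := 0)
    (hom_ext fun v w => by simp) x

@[simp]
theorem right_smul_tmul (r : Rᵐᵒᵖ) (v : V) (w : W) : r • tmul R v w = tmul R v (r • w) := rfl

end

instance [Module R V] [Module Rᵐᵒᵖ V] [SMulCommClass R Rᵐᵒᵖ V] [Module R W] [Module Rᵐᵒᵖ W]
    [SMulCommClass R Rᵐᵒᵖ W] : SMulCommClass R Rᵐᵒᵖ (BalTensor R V W) where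
  smul_comm r r' x := by
    induction x using induction_on with
    | zero => simp
    | pure v w => simp
    | add x y hx hy => simp [hx, hy]

end BalTensor

end BalancedTensor

/-! ### The monoidal category of `R`-`R`-bimodules -/

/-- An `R`-`R`-bimodule; the right action is written as an action of `Rᵐᵒᵖ`. -/
structure Bimodule (R : Type u) [Ring R] where
  carrier : Type u
  [addCommGroup : AddCommGroup carrier]
  [left : Module R carrier]
  [right : Module Rᵐᵒᵖ carrier]
  [comm : SMulCommClass R Rᵐᵒᵖ carrier]

namespace Bimodule

attribute [instance] Bimodule.addCommGroup Bimodule.left Bimodule.right Bimodule.comm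

variable {R : Type u} [Ring R]

/-- A homomorphism of `R`-`R`-bimodules. -/
@[ext]
structure Hom (V W : Bimodule R) where
  hom : V.carrier →+ W.carrier
  map_left : ∀ (r : R) v, hom (r • v) = r • hom v
  map_right : ∀ (r : Rᵐᵒᵖ) v, hom (r • v) = r • hom v

instance : Category (Bimodule R) where
  Hom V W := Hom V W
  id V := ⟨AddMonoidHom.id _, fun _ _ => rfl, fun _ _ => rfl⟩
  comp f g := ⟨g.hom.comp f.hom, fun r v => by simp [f.map_left, g.map_left],
    fun r v => by simp [f.map_right, g.map_right]⟩

@[simp] theorem id_hom (V : Bimodule R) : Hom.hom (𝟙 V) = AddMonoidHom.id _ := rfl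

@[simp] theorem comp_hom {V W X : Bimodule R} (f : V ⟶ W) (g : W ⟶ X) :
    Hom.hom (f ≫ g) = g.hom.comp f.hom := rfl

@[ext] theorem hom_ext' {V W : Bimodule R} {f g : V ⟶ W} (h : f.hom = g.hom) : f = g :=
  Hom.ext h

/-- The bimodule `V ⊗_R W` with its outer actions. -/
noncomputable def tensor (V W : Bimodule R) : Bimodule R where
  carrier := BalTensor R V.carrier W.carrier

variable (R) in
/-- The regular bimodule `R`. -/
def regular : Bimodule R where
  carrier := R

/-- An element of the ring, as an element of the regular bimodule. -/
def regular.of (r : R) : (regular R).carrier := r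

/-- The pure tensor `v ⊗_R w`. -/
noncomputable def tmul {V W : Bimodule R} (v : V.carrier) (w : W.carrier) : (tensor V W).carrier :=
  BalTensor.tmul R v w

section

variable {U V W X Y T : Bimodule R}

theorem regular.of_surjective : Function.Surjective (regular.of (R := R)) := fun r => ⟨r, rfl⟩

@[simp]
theorem regular.left_smul (r r' : R) : r • regular.of r' = regular.of (r * r') := rfl

@[simp]
theorem regular.right_smul (r : R) (r' : R) : op r • regular.of r' = regular.of (r' * r) := rfl

theorem add_tmul (v v' : V.carrier) (w : W.carrier) : tmul (v + v') w = tmul v w + tmul v' w :=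
  BalTensor.add_tmul R v v' w

theorem tmul_add (v : V.carrier) (w w' : W.carrier) : tmul v (w + w') = tmul v w + tmul v w' :=
  BalTensor.tmul_add R v w w'

@[simp]
theorem zero_tmul (w : W.carrier) : tmul (0 : V.carrier) w = 0 := BalTensor.zero_tmul R w

@[simp]
theorem tmul_zero (v : V.carrier) : tmul v (0 : W.carrier) = 0 := BalTensor.tmul_zero R v

theorem smul_tmul (v : V.carrier) (r : R) (w : W.carrier) : tmul (op r • v) w = tmul v (r • w) :=
  BalTensor.smul_tmul R v r w

@[simp]
theorem left_smul_tmul (r : R) (v : V.carrier) (w : W.carrier) :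
    r • tmul v w = tmul (r • v) w := rfl

@[simp]
theorem right_smul_tmul (r : Rᵐᵒᵖ) (v : V.carrier) (w : W.carrier) :
    r • tmul v w = tmul v (r • w) := rfl

@[elab_as_elim]
theorem tensor_induction {P : (tensor V W).carrier → Prop} (x : (tensor V W).carrier) (zero : P 0)
    (pure : ∀ v w, P (tmul v w)) (add : ∀ x y, P x → P y → P (x + y)) : P x :=
  @BalTensor.induction_on R _ V.carrier W.carrier _ _ _ _ P x zero pure add

theorem tensor_hom_ext {f g : tensor V W ⟶ X} (h : ∀ v w, f.hom (tmul v w) = g.hom (tmul v w)) :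
    f = g :=
  hom_ext' (BalTensor.hom_ext h)

theorem tensor_hom_ext_left {f g : tensor (tensor V W) X ⟶ Y}
    (h : ∀ v w x, f.hom (tmul (tmul v w) x) = g.hom (tmul (tmul v w) x)) : f = g :=
  tensor_hom_ext fun v x => by
    induction v using tensor_induction with
    | zero => simp
    | pure v w => exact h v w x
    | add a b ha hb => rw [add_tmul, map_add, map_add, ha, hb]

theorem tensor_hom_ext_right {f g : tensor V (tensor W X) ⟶ Y}
    (h : ∀ v w x, f.hom (tmul v (tmul w x)) = g.hom (tmul v (tmul w x))) : f = g :=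
  tensor_hom_ext fun v x => by
    induction x using tensor_induction with
    | zero => simp
    | pure w x => exact h v w x
    | add a b ha hb => rw [tmul_add, map_add, map_add, ha, hb]

theorem tensor_hom_ext_four {f g : tensor (tensor (tensor V W) X) Y ⟶ T}
    (h : ∀ v w x y, f.hom (tmul (tmul (tmul v w) x) y) = g.hom (tmul (tmul (tmul v w) x) y)) :
    f = g :=
  tensor_hom_ext_left fun v x y => by
    induction v using tensor_induction with
    | zero => simp
    | pure v w => exact h v w x y
    | add a b ha hb => rw [add_tmul, add_tmul, map_add, map_add, ha, hb]

/-- The additive map on `V ⊗_R W` induced by a balanced biadditive map. -/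
noncomputable def liftAdd {X : Type u} [AddCommGroup X] (f : V.carrier →+ W.carrier →+ X)
    (h : ∀ v (r : R) w, f (op r • v) w = f v (r • w)) : (tensor V W).carrier →+ X :=
  BalTensor.lift f h

@[simp]
theorem liftAdd_tmul {X : Type u} [AddCommGroup X] (f : V.carrier →+ W.carrier →+ X)
    (h : ∀ v (r : R) w, f (op r • v) w = f v (r • w)) (v : V.carrier) (w : W.carrier) :
    liftAdd f h (tmul v w) = f v w := rfl

/-- A balanced biadditive map, linear for the outer actions, as a bimodule map on `V ⊗_R W`. -/
noncomputable def lift (f : V.carrier →+ W.carrier →+ X.carrier)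
    (h : ∀ v (r : R) w, f (op r • v) w = f v (r • w))
    (hl : ∀ (r : R) v w, f (r • v) w = r • f v w)
    (hr : ∀ (r : Rᵐᵒᵖ) v w, f v (r • w) = r • f v w) : tensor V W ⟶ X where
  hom := liftAdd f h
  map_left r x := by
    induction x using tensor_induction with
    | zero => simp
    | pure v w => simp [hl]
    | add x y hx hy => rw [smul_add, map_add, hx, hy, map_add, smul_add]
  map_right r x := by
    induction x using tensor_induction with
    | zero => simp
    | pure v w => simp [hr]
    | add x y hx hy => rw [smul_add, map_add, hx, hy, map_add, smul_add]

@[simp]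
theorem lift_hom_tmul (f : V.carrier →+ W.carrier →+ X.carrier)
    (h : ∀ v (r : R) w, f (op r • v) w = f v (r • w))
    (hl : ∀ (r : R) v w, f (r • v) w = r • f v w)
    (hr : ∀ (r : Rᵐᵒᵖ) v w, f v (r • w) = r • f v w) (v : V.carrier) (w : W.carrier) :
    (lift f h hl hr).hom (tmul v w) = f v w := rfl

end

/-- The biadditive map `(v, w) ↦ v ⊗ w`. -/
noncomputable def tmulHom (V W : Bimodule R) :
    V.carrier →+ W.carrier →+ (tensor V W).carrier :=
  AddMonoidHom.mk' (fun v => AddMonoidHom.mk' (tmul v) (tmul_add v))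
    (fun v v' => by ext w; simp [add_tmul])

@[simp]
theorem tmulHom_apply (V W : Bimodule R) (v : V.carrier) (w : W.carrier) :
    tmulHom V W v w = tmul v w := rfl

/-- The bimodule map `v ⊗ w ↦ f v ⊗ g w`. -/
noncomputable def tensorMap {V V' W W' : Bimodule R} (f : V ⟶ V') (g : W ⟶ W') :
    tensor V W ⟶ tensor V' W' :=
  lift (((tmulHom V' W').comp f.hom).compl₂ g.hom)
    (fun v r w => by simp [f.map_right, g.map_left, smul_tmul])
    (fun r v w => by simp [f.map_left]) (fun r v w => by simp [g.map_right])

@[simp]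
theorem tensorMap_hom_tmul {V V' W W' : Bimodule R} (f : V ⟶ V') (g : W ⟶ W')
    (v : V.carrier) (w : W.carrier) :
    (tensorMap f g).hom (tmul v w) = tmul (f.hom v) (g.hom w) := rfl

/-- `(u ⊗ v) ⊗ w ↦ u ⊗ (v ⊗ w)` -/
noncomputable def assocHom (U V W : Bimodule R) :
    tensor (tensor U V) W ⟶ tensor U (tensor V W) :=
  lift (liftAdd
      (AddMonoidHom.mk' (fun u => (tmulHom V W).compr₂ (tmulHom U (tensor V W) u))
        (fun u u' => by ext v w; simp))
      (fun u r v => by ext w; simp [smul_tmul]))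
    (fun x r w => by
      induction x using tensor_induction with
      | zero => simp
      | pure u v => simp [smul_tmul]
      | add x y hx hy => simp only [smul_add, map_add, AddMonoidHom.add_apply, hx, hy])
    (fun r x w => by
      induction x using tensor_induction with
      | zero => simp
      | pure u v => simp
      | add x y hx hy => simp only [smul_add, map_add, AddMonoidHom.add_apply, hx, hy])
    (fun r x w => by
      induction x using tensor_induction with
      | zero => simp
      | pure u v => simp
      | add x y hx hy => simp only [smul_add, map_add, AddMonoidHom.add_apply, hx, hy])

@[simp]
theorem assocHom_hom_tmul (U V W : Bimodule R) (u : U.carrier) (v : V.carrier) (w : W.carrier) :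
    (assocHom U V W).hom (tmul (tmul u v) w) = tmul u (tmul v w) := rfl

/-- The additive map `v ⊗ w ↦ (u ⊗ v) ⊗ w`. -/
noncomputable def assocInvAux (U V W : Bimodule R) (u : U.carrier) :
    (tensor V W).carrier →+ (tensor (tensor U V) W).carrier :=
  liftAdd ((tmulHom (tensor U V) W).comp (tmulHom U V u))
    (fun v r w => by simp [← smul_tmul])

@[simp]
theorem assocInvAux_tmul (U V W : Bimodule R) (u : U.carrier) (v : V.carrier) (w : W.carrier) :
    assocInvAux U V W u (tmul v w) = tmul (tmul u v) w := rfl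

/-- `u ⊗ (v ⊗ w) ↦ (u ⊗ v) ⊗ w` -/
noncomputable def assocInv (U V W : Bimodule R) :
    tensor U (tensor V W) ⟶ tensor (tensor U V) W :=
  lift (AddMonoidHom.mk' (assocInvAux U V W)
      (fun u u' => by
        ext x
        induction x using tensor_induction with
        | zero => simp
        | pure v w => simp [add_tmul]
        | add x y hx hy => rw [map_add, map_add, hx, hy]))
    (fun u r x => by
      induction x using tensor_induction with
      | zero => simp
      | pure v w => simp [smul_tmul]
      | add x y hx hy => simp only [smul_add, map_add, hx, hy])
    (fun r u x => by
      induction x using tensor_induction with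
      | zero => simp
      | pure v w => simp
      | add x y hx hy => simp only [smul_add, map_add, hx, hy])
    (fun r u x => by
      induction x using tensor_induction with
      | zero => simp
      | pure v w => simp
      | add x y hx hy => simp only [smul_add, map_add, hx, hy])

@[simp]
theorem assocInv_hom_tmul (U V W : Bimodule R) (u : U.carrier) (v : V.carrier) (w : W.carrier) :
    (assocInv U V W).hom (tmul u (tmul v w)) = tmul (tmul u v) w := rfl

/-- The associativity isomorphism of bimodules. -/
noncomputable def assoc (U V W : Bimodule R) :
    tensor (tensor U V) W ≅ tensor U (tensor V W) where
  hom := assocHom U V W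
  inv := assocInv U V W
  hom_inv_id := tensor_hom_ext_left fun u v w => by simp
  inv_hom_id := tensor_hom_ext_right fun u v w => by simp

/-- `r ⊗ v ↦ r · v` -/
noncomputable def leftUnitHom (V : Bimodule R) : tensor (regular R) V ⟶ V :=
  lift (AddMonoidHom.mk' (fun r : R => DistribSMul.toAddMonoidHom V.carrier r)
      (fun r r' => by ext v; simp [add_smul]) : R →+ V.carrier →+ V.carrier)
    (fun (r : R) r' v => mul_smul r r' v) (fun r (r' : R) v => mul_smul r r' v)
    (fun r (r' : R) v => smul_comm r' r v)

@[simp]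
theorem leftUnitHom_hom_tmul (V : Bimodule R) (r : R) (v : V.carrier) :
    (leftUnitHom V).hom (tmul (regular.of r) v) = r • v := rfl

/-- The isomorphism `R ⊗_R V ≅ V`, `r ⊗ v ↦ r · v`. -/
noncomputable def leftUnit (V : Bimodule R) : tensor (regular R) V ≅ V where
  hom := leftUnitHom V
  inv :=
    { hom := tmulHom (regular R) V (regular.of 1)
      map_left := fun r v => by simp [← smul_tmul]
      map_right := fun r v => by simp }
  hom_inv_id := tensor_hom_ext fun r v => by
    obtain ⟨r, rfl⟩ := regular.of_surjective r
    simp [← smul_tmul]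
  inv_hom_id := by ext v; simp

/-- `v ⊗ r ↦ v · r` -/
noncomputable def rightUnitHom (V : Bimodule R) : tensor V (regular R) ⟶ V :=
  lift ((AddMonoidHom.mk' (fun r : R => DistribSMul.toAddMonoidHom V.carrier (op r))
      (fun r r' => by ext v; simp [add_smul])).flip : V.carrier →+ R →+ V.carrier)
    (fun v r (r' : R) => (mul_smul (op r') (op r) v).symm)
    (fun r v (r' : R) => (smul_comm r (op r') v).symm)
    (fun r v (r' : R) => mul_smul r (op r') v)

@[simp]
theorem rightUnitHom_hom_tmul (V : Bimodule R) (v : V.carrier) (r : R) :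
    (rightUnitHom V).hom (tmul v (regular.of r)) = op r • v := rfl

/-- The isomorphism `V ⊗_R R ≅ V`, `v ⊗ r ↦ v · r`. -/
noncomputable def rightUnit (V : Bimodule R) : tensor V (regular R) ≅ V where
  hom := rightUnitHom V
  inv :=
    { hom := (tmulHom V (regular R)).flip (regular.of 1)
      map_left := fun r v => by simp
      map_right := fun r v => by
        obtain ⟨r, rfl⟩ := op_surjective r
        simp [smul_tmul] }
  hom_inv_id := tensor_hom_ext fun v r => by
    obtain ⟨r, rfl⟩ := regular.of_surjective r
    simp [smul_tmul]
  inv_hom_id := by ext v; simp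

/-- The monoidal category of `R`-`R`-bimodules, with `⊗_R` and unit object `R`. -/
noncomputable instance : MonoidalCategory (Bimodule R) where
  tensorObj := tensor
  tensorUnit := regular R
  tensorHom := tensorMap
  whiskerLeft V _ _ f := tensorMap (𝟙 V) f
  whiskerRight f V := tensorMap f (𝟙 V)
  associator := assoc
  leftUnitor := leftUnit
  rightUnitor := rightUnit
  tensorHom_def _ _ := tensor_hom_ext fun v w => by simp
  id_tensorHom_id _ _ := tensor_hom_ext fun v w => by simp
  tensorHom_comp_tensorHom _ _ _ _ := tensor_hom_ext fun v w => by simp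
  whiskerLeft_id _ _ := tensor_hom_ext fun v w => by simp
  id_whiskerRight _ _ := tensor_hom_ext fun v w => by simp
  associator_naturality _ _ _ := tensor_hom_ext_left fun u v w => by simp [assoc]
  leftUnitor_naturality f := tensor_hom_ext fun r v => by
    obtain ⟨r, rfl⟩ := regular.of_surjective r
    simp [leftUnit, f.map_left]
  rightUnitor_naturality f := tensor_hom_ext fun v r => by
    obtain ⟨r, rfl⟩ := regular.of_surjective r
    simp [rightUnit, f.map_right]
  pentagon _ _ _ _ := tensor_hom_ext_four fun v w x y => by simp [assoc]
  triangle _ _ := tensor_hom_ext_left fun v r w => by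
    obtain ⟨r, rfl⟩ := regular.of_surjective r
    simp [assoc, leftUnit, rightUnit, smul_tmul]

end Bimodule

/-! ### Strictly monoidal functors -/

/-- A functor with a (lax) monoidal structure is strictly monoidal if it preserves unit object and
tensor products on the nose and its structure morphisms are the identities. -/
structure IsStrictMonoidal {C D : Type*} [Category* C] [MonoidalCategory C] [Category* D]
    [MonoidalCategory D] (F : C ⥤ D) [F.LaxMonoidal] : Prop where
  unit_eq : 𝟙_ D = F.obj (𝟙_ C)
  tensor_eq : ∀ X Y : C, F.obj X ⊗ F.obj Y = F.obj (X ⊗ Y)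
  ε_eq : Functor.LaxMonoidal.ε F = eqToHom unit_eq
  μ_eq : ∀ X Y : C, Functor.LaxMonoidal.μ F X Y = eqToHom (tensor_eq X Y)

/-! ### Monoidal structures on the category of right `A`-modules -/

/-- A monoidal structure on the (additive) category of right `A`-modules, i.e. of left
`Aᵐᵒᵖ`-modules; the tensor product is additive in each variable. -/
structure MonStr (A : Type u) [Ring A] where
  mon : MonoidalCategory (ModuleCat.{u} Aᵐᵒᵖ)
  preadditive : MonoidalPreadditive (ModuleCat.{u} Aᵐᵒᵖ)

namespace MonStr

variable {A : Type u} [Ring A] (M M' : MonStr A)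

/-- The category of right `A`-modules, equipped with the monoidal structure `M`. -/
def Mod (_ : MonStr A) : Type (u + 1) := ModuleCat.{u} Aᵐᵒᵖ

instance : Category.{u} M.Mod := inferInstanceAs (Category.{u} (ModuleCat.{u} Aᵐᵒᵖ))
instance : Preadditive M.Mod := inferInstanceAs (Preadditive (ModuleCat.{u} Aᵐᵒᵖ))
instance : MonoidalCategory M.Mod := M.mon
instance : MonoidalPreadditive M.Mod := M.preadditive

/-- Forget the monoidal structure (the identity functor). -/
def toModuleCat : M.Mod ⥤ ModuleCat.{u} Aᵐᵒᵖ := 𝟭 (ModuleCat.{u} Aᵐᵒᵖ)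

/-- The identity functor of the category of right `A`-modules, seen as a functor between
two monoidal categories. -/
def idFunctor : M.Mod ⥤ M'.Mod := 𝟭 (ModuleCat.{u} Aᵐᵒᵖ)

/-- The underlying additive group of a right `A`-module. -/
abbrev El (V : M.Mod) : Type u := M.toModuleCat.obj V

variable {M} in
/-- The underlying additive map of a morphism of right `A`-modules. -/
def ap {V W : M.Mod} (f : V ⟶ W) : M.El V →+ M.El W := (M.toModuleCat.map f).hom.toAddMonoidHom

section
variable {M}

@[simp] theorem ap_id (V : M.Mod) (v : M.El V) : ap (𝟙 V) v = v := rfl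

@[simp] theorem ap_comp {V W X : M.Mod} (f : V ⟶ W) (g : W ⟶ X) (v : M.El V) :
    ap (f ≫ g) v = ap g (ap f v) := rfl

@[simp] theorem ap_add {V W : M.Mod} (f g : V ⟶ W) (v : M.El V) :
    ap (f + g) v = ap f v + ap g v := rfl

@[simp] theorem ap_zero {V W : M.Mod} (v : M.El V) : ap (0 : V ⟶ W) v = 0 := rfl

end

/-- The endomorphism ring `Z` of the monoidal unit. -/
abbrev Z : Type u := End (𝟙_ M.Mod)

/-- `z : Z` acts from the left on `V` by `V ≅ U ⊗ V → U ⊗ V ≅ V`. -/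
def leftEnd (z : M.Z) (V : M.Mod) : V ⟶ V := (λ_ V).inv ≫ (z : 𝟙_ M.Mod ⟶ 𝟙_ M.Mod) ▷ V ≫ (λ_ V).hom

/-- `z : Z` acts from the right on `V` by `V ≅ V ⊗ U → V ⊗ U ≅ V`. -/
def rightEnd (z : M.Z) (V : M.Mod) : V ⟶ V := (ρ_ V).inv ≫ V ◁ (z : 𝟙_ M.Mod ⟶ 𝟙_ M.Mod) ≫ (ρ_ V).hom

section

variable {M}

theorem leftEnd_naturality (z : M.Z) {V W : M.Mod} (f : V ⟶ W) :
    M.leftEnd z V ≫ f = f ≫ M.leftEnd z W := by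
  simp only [leftEnd, Category.assoc, ← leftUnitor_naturality f]
  rw [← whisker_exchange_assoc, leftUnitor_inv_naturality_assoc]

theorem rightEnd_naturality (z : M.Z) {V W : M.Mod} (f : V ⟶ W) :
    M.rightEnd z V ≫ f = f ≫ M.rightEnd z W := by
  simp only [rightEnd, Category.assoc, ← rightUnitor_naturality f]
  rw [whisker_exchange_assoc, rightUnitor_inv_naturality_assoc]

theorem rightEnd_unit (z : M.Z) : M.rightEnd z (𝟙_ M.Mod) = z := by
  rw [rightEnd, ← unitors_equal, leftUnitor_naturality, ← unitors_inv_equal,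
    Iso.inv_hom_id_assoc]

theorem Z_comp_comm (z z' : M.Z) :
    (z : 𝟙_ M.Mod ⟶ 𝟙_ M.Mod) ≫ z' = (z' : 𝟙_ M.Mod ⟶ 𝟙_ M.Mod) ≫ z := by
  simpa only [rightEnd_unit] using rightEnd_naturality z (z' : 𝟙_ M.Mod ⟶ 𝟙_ M.Mod)

theorem leftEnd_one (V : M.Mod) : M.leftEnd 1 V = 𝟙 V := by
  change _ ≫ 𝟙 (𝟙_ M.Mod) ▷ V ≫ _ = _
  simp

theorem rightEnd_one (V : M.Mod) : M.rightEnd 1 V = 𝟙 V := by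
  change _ ≫ V ◁ 𝟙 (𝟙_ M.Mod) ≫ _ = _
  simp

theorem leftEnd_mul (z z' : M.Z) (V : M.Mod) :
    M.leftEnd (z * z') V = M.leftEnd z' V ≫ M.leftEnd z V := by
  simp [leftEnd, End.mul_def]

theorem rightEnd_mul (z z' : M.Z) (V : M.Mod) :
    M.rightEnd (z * z') V = M.rightEnd z V ≫ M.rightEnd z' V := by
  rw [End.mul_def, ← Z_comp_comm]
  simp [rightEnd]

theorem leftEnd_add (z z' : M.Z) (V : M.Mod) :
    M.leftEnd (z + z') V = M.leftEnd z V + M.leftEnd z' V := by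
  change _ ≫ ((z : 𝟙_ M.Mod ⟶ 𝟙_ M.Mod) + z') ▷ V ≫ _ = _
  rw [MonoidalPreadditive.add_whiskerRight, Preadditive.add_comp, Preadditive.comp_add]
  rfl

theorem rightEnd_add (z z' : M.Z) (V : M.Mod) :
    M.rightEnd (z + z') V = M.rightEnd z V + M.rightEnd z' V := by
  change _ ≫ V ◁ ((z : 𝟙_ M.Mod ⟶ 𝟙_ M.Mod) + z') ≫ _ = _
  rw [MonoidalPreadditive.whiskerLeft_add, Preadditive.add_comp, Preadditive.comp_add]
  rfl

theorem leftEnd_zero (V : M.Mod) : M.leftEnd 0 V = 0 := by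
  change _ ≫ (0 : 𝟙_ M.Mod ⟶ 𝟙_ M.Mod) ▷ V ≫ _ = _
  simp

theorem rightEnd_zero (V : M.Mod) : M.rightEnd 0 V = 0 := by
  change _ ≫ V ◁ (0 : 𝟙_ M.Mod ⟶ 𝟙_ M.Mod) ≫ _ = _
  simp

end

/-- The left action of `Z` on a right `A`-module. -/
@[reducible] def leftModule (V : M.Mod) : Module M.Z (M.El V) where
  smul z v := ap (M.leftEnd z V) v
  one_smul v := by change ap (M.leftEnd 1 V) v = v; rw [leftEnd_one, ap_id]
  mul_smul z z' v := by
    change ap (M.leftEnd (z * z') V) v = ap (M.leftEnd z V) (ap (M.leftEnd z' V) v)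
    rw [leftEnd_mul, ap_comp]
  smul_zero z := map_zero (ap (M.leftEnd z V))
  smul_add z := map_add (ap (M.leftEnd z V))
  add_smul z z' v := by
    change ap (M.leftEnd (z + z') V) v = ap (M.leftEnd z V) v + ap (M.leftEnd z' V) v
    simp [leftEnd_add]
  zero_smul v := by change ap (M.leftEnd 0 V) v = 0; simp [leftEnd_zero]

/-- The right action of `Z` on a right `A`-module. -/
@[reducible] def rightModule (V : M.Mod) : Module M.Zᵐᵒᵖ (M.El V) where
  smul z v := ap (M.rightEnd z.unop V) v
  one_smul v := by change ap (M.rightEnd 1 V) v = v; rw [rightEnd_one, ap_id]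
  mul_smul z z' v := by
    change ap (M.rightEnd (z'.unop * z.unop) V) v =
      ap (M.rightEnd z.unop V) (ap (M.rightEnd z'.unop V) v)
    rw [rightEnd_mul, ap_comp]
  smul_zero z := map_zero (ap (M.rightEnd z.unop V))
  smul_add z := map_add (ap (M.rightEnd z.unop V))
  add_smul z z' v := by
    change ap (M.rightEnd (z.unop + z'.unop) V) v =
      ap (M.rightEnd z.unop V) v + ap (M.rightEnd z'.unop V) v
    simp [rightEnd_add]
  zero_smul v := by change ap (M.rightEnd 0 V) v = 0; simp [rightEnd_zero]

/-- The forgetful functor `φ_Z` from right `A`-modules to `Z`-`Z`-bimodules. -/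
def forgetZ : M.Mod ⥤ Bimodule M.Z where
  obj V :=
    letI := M.leftModule V
    letI := M.rightModule V
    { carrier := M.El V
      comm := ⟨fun z z' v =>
        (congrArg (ap · v) (leftEnd_naturality z (M.rightEnd z'.unop V))).symm⟩ }
  map {V W} f :=
    { hom := ap f
      map_left := fun z v => congrArg (ap · v) (leftEnd_naturality z f)
      map_right := fun z v => congrArg (ap · v) (rightEnd_naturality z.unop f) }

/-- A monoidal structure `⟨φ_Z, μ, ζ⟩` on the forgetful functor `φ_Z` such that the sequence
`V ⊗_Z (U ⊗_Z W) ⇉ V ⊗_Z W → V ⊗ W → 0`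
is exact for all right `A`-modules `V` and `W`. The upper arrow is `V ⊗_Z λ_W`, the lower one is
`ρ_V ⊗_Z W` preceded by the associativity isomorphism, where
`λ_W : U ⊗_Z W → U ⊗ W ≅ W` and `ρ_V : V ⊗_Z U → V ⊗ U ≅ V` are built from `μ`. -/
structure ExactMonoidalForget where
  lax : M.forgetZ.LaxMonoidal
  exact (V W : M.Mod) : Function.Exact
    ((M.forgetZ.obj V ◁ (lax.μ (𝟙_ M.Mod) W ≫ M.forgetZ.map (λ_ W).hom)).hom -
      ((α_ (M.forgetZ.obj V) (M.forgetZ.obj (𝟙_ M.Mod)) (M.forgetZ.obj W)).inv ≫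
        (lax.μ V (𝟙_ M.Mod) ≫ M.forgetZ.map (ρ_ V).hom) ▷ M.forgetZ.obj W).hom)
    (lax.μ V W).hom
  surjective (V W : M.Mod) : Function.Surjective (lax.μ V W).hom

namespace ExactMonoidalForget

variable {M} (L : M.ExactMonoidalForget)

/-- `μ_{V,W} (v ⊗_Z w)` -/
noncomputable def mu {V W : M.Mod} (v : M.El V) (w : M.El W) : M.El (V ⊗ W) :=
  (L.lax.μ V W).hom (Bimodule.tmul (V := M.forgetZ.obj V) (W := M.forgetZ.obj W) v w)

/-- `ζ (z)` -/
noncomputable def zeta (z : M.Z) : M.El (𝟙_ M.Mod) := L.lax.ε.hom (Bimodule.regular.of z)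

end ExactMonoidalForget

end MonStr

/-! ### Bialgebroids -/

/-- Rings and ring homomorphisms `Rᵒᵖ → A ← R` (target and source) with commuting images. -/
structure SourceTarget (A : Type u) [Ring A] where
  R : Type u
  [ring : Ring R]
  s : R →+* A
  t : Rᵐᵒᵖ →+* A
  commute : ∀ r r', Commute (s r) (t r')

namespace SourceTarget

attribute [instance] SourceTarget.ring

variable {A : Type u} [Ring A] (S : SourceTarget A)

/-- The left action `r · v = v t(r)` of `R` on a right `A`-module. -/
@[reducible] def leftModule (V : Type u) [AddCommGroup V] [Module Aᵐᵒᵖ V] : Module S.R V where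
  smul r v := op (S.t (op r)) • v
  one_smul v := by change op (S.t (op 1)) • v = v; simp
  mul_smul r r' v := by
    change op (S.t (op (r * r'))) • v = op (S.t (op r)) • op (S.t (op r')) • v
    simp [mul_smul]
  smul_zero r := smul_zero (op (S.t (op r)))
  smul_add r := smul_add (op (S.t (op r)))
  add_smul r r' v := by
    change op (S.t (op (r + r'))) • v = op (S.t (op r)) • v + op (S.t (op r')) • v
    simp [add_smul]
  zero_smul v := by change op (S.t (op 0)) • v = 0; simp

/-- The right action `v · r = v s(r)` of `R` on a right `A`-module. -/
@[reducible] def rightModule (V : Type u) [AddCommGroup V] [Module Aᵐᵒᵖ V] :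
    Module S.Rᵐᵒᵖ V where
  smul r v := op (S.s r.unop) • v
  one_smul v := by change op (S.s 1) • v = v; simp
  mul_smul r r' v := by
    change op (S.s (r'.unop * r.unop)) • v = op (S.s r.unop) • op (S.s r'.unop) • v
    simp [mul_smul]
  smul_zero r := smul_zero (op (S.s r.unop))
  smul_add r := smul_add (op (S.s r.unop))
  add_smul r r' v := by
    change op (S.s (r.unop + r'.unop)) • v = op (S.s r.unop) • v + op (S.s r'.unop) • v
    simp [add_smul]
  zero_smul v := by change op (S.s 0) • v = 0; simp

/-- The forgetful functor `φ_R` from right `A`-modules, with the monoidal structure `M`, to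
`R`-`R`-bimodules. -/
def forgetR (M : MonStr A) : M.Mod ⥤ Bimodule S.R where
  obj V :=
    letI := S.leftModule (M.El V)
    letI := S.rightModule (M.El V)
    { carrier := M.El V
      comm := ⟨fun r r' v => by
        change op (S.t (op r)) • op (S.s r'.unop) • v = op (S.s r'.unop) • op (S.t (op r)) • v
        rw [← mul_smul, ← mul_smul, ← op_mul, ← op_mul, (S.commute r'.unop (op r)).eq]⟩ }
  map {V W} f :=
    { hom := MonStr.ap f
      map_left := fun r v => (M.toModuleCat.map f).hom.map_smul (op (S.t (op r))) v
      map_right := fun r v => (M.toModuleCat.map f).hom.map_smul (op (S.s r.unop)) v }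

end SourceTarget

/-- A bialgebroid structure on the ring `A`: a base ring `R` with source and target maps, and a
monoidal structure on the category of right `A`-modules such that the forgetful functor to
`R`-`R`-bimodules is strictly monoidal. -/
structure BialgebroidStr (A : Type u) [Ring A] extends SourceTarget A, MonStr A where
  lax : (toSourceTarget.forgetR toMonStr).LaxMonoidal
  strict : IsStrictMonoidal (toSourceTarget.forgetR toMonStr)

namespace BialgebroidStr

variable {A : Type u} [Ring A] (B : BialgebroidStr A)

/-- The element `v ⊗_R w` of `V ⊗ W = V ⊗_R W`. -/
noncomputable def tmul {V W : B.Mod} (v : B.El V) (w : B.El W) : B.El (V ⊗ W) :=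
  (B.lax.μ V W).hom (Bimodule.tmul (V := (B.forgetR B.toMonStr).obj V)
    (W := (B.forgetR B.toMonStr).obj W) v w)

/-- The element `r` of `U = R`. -/
noncomputable def unitEl (r : B.R) : B.El (𝟙_ B.Mod) := B.lax.ε.hom (Bimodule.regular.of r)

end BialgebroidStr

/-- The categorical data: a monoidal structure on right `A`-modules and an exact monoidal
structure on `φ_Z`. -/
structure CategoricalData (A : Type u) [Ring A] extends MonStr A where
  L : toMonStr.ExactMonoidalForget

/-! ### Isomorphisms of the two kinds of structure -/

namespace MonStr

variable {A : Type u} [Ring A] {M M' M'' : MonStr A}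

variable (M') in
/-- An element of a right `A`-module `V`, as an element of the image of `V` under `idFunctor`. -/
def idEl {V : M.Mod} (v : M.El V) : M'.El ((M.idFunctor M').obj V) := v

/-- An isomorphism of monoidal structures on right `A`-modules: a strong monoidal structure on
the identity functor. -/
abbrev Iso (M M' : MonStr A) : Type (u + 1) := (M.idFunctor M').Monoidal

namespace Iso

variable (θ : Iso M M') (θ' : Iso M' M'')

/-- The isomorphism `U' ≅ U` of unit objects. -/
abbrev unitHom : 𝟙_ M'.Mod ⟶ (M.idFunctor M').obj (𝟙_ M.Mod) := θ.ε

/-- The isomorphism `V ⊗' W ≅ V ⊗ W` of tensor products. -/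
abbrev tensorHom (V W : M.Mod) :
    (M.idFunctor M').obj V ⊗ (M.idFunctor M').obj W ⟶ (M.idFunctor M').obj (V ⊗ W) := θ.μ V W

/-- The map on endomorphisms of the unit objects induced by `U' ≅ U`. -/
def mapZ (z : M.Z) : M'.Z := θ.ε ≫ (M.idFunctor M').map (z : 𝟙_ M.Mod ⟶ 𝟙_ M.Mod) ≫ θ.η

/-- The identity isomorphism. -/
@[reducible] def refl (M : MonStr A) : Iso M M := inferInstanceAs (𝟭 M.Mod).Monoidal

/-- The composite isomorphism. -/
@[reducible] def trans : Iso M M'' :=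
  letI : (M.idFunctor M').Monoidal := θ
  letI : (M'.idFunctor M'').Monoidal := θ'
  inferInstanceAs (M.idFunctor M' ⋙ M'.idFunctor M'').Monoidal

/-- The inverse isomorphism. -/
@[reducible] def symm : Iso M' M where
  ε := θ.η
  μ V W := θ.δ V W
  η := θ.ε
  δ V W := θ.μ V W
  μ_natural_left f X := (θ.δ_natural_left f X).symm
  μ_natural_right X f := (θ.δ_natural_right X f).symm
  associativity X Y Z :=
    (Category.assoc _ _ _).symm.trans <|
      (congrArg (· ≫ (α_ (X : M'.Mod) (Y : M'.Mod) (Z : M'.Mod)).hom)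
        (θ.δ_natural_left (X := (X ⊗ Y : M.Mod)) (θ.δ X Y) Z).symm).trans <|
      (Category.assoc _ _ _).trans <|
      (θ.oplax_associativity X Y Z).trans <|
      congrArg ((α_ (show M.Mod from X) (show M.Mod from Y) (show M.Mod from Z)).hom ≫ ·)
        (θ.δ_natural_right X (X := (Y ⊗ Z : M.Mod)) (θ.δ Y Z))
  left_unitality X :=
    ((Category.assoc _ _ _).symm.trans <|
      (congrArg (· ≫ (λ_ (X : M'.Mod)).hom)
        (θ.δ_natural_left (X := 𝟙_ M.Mod) θ.η X).symm).trans <|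
      (Category.assoc _ _ _).trans <| Functor.OplaxMonoidal.left_unitality_hom (M.idFunctor M') X).symm
  right_unitality X :=
    ((Category.assoc _ _ _).symm.trans <|
      (congrArg (· ≫ (ρ_ (X : M'.Mod)).hom)
        (θ.δ_natural_right X (X := 𝟙_ M.Mod) θ.η).symm).trans <|
      (Category.assoc _ _ _).trans <| Functor.OplaxMonoidal.right_unitality_hom (M.idFunctor M') X).symm
  δ_natural_left f X := (θ.μ_natural_left f X).symm
  δ_natural_right X f := (θ.μ_natural_right X f).symm
  oplax_associativity X Y Z :=
    (Category.assoc _ _ _).symm.trans <|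
      (congrArg (· ≫ (α_ (show M.Mod from X) (show M.Mod from Y) (show M.Mod from Z)).hom)
        (θ.μ_natural_left (Y := (X ⊗ Y : M.Mod)) (θ.μ X Y) Z).symm).trans <|
      (Category.assoc _ _ _).trans <|
      (θ.associativity X Y Z).trans <|
      congrArg ((α_ (X : M'.Mod) (Y : M'.Mod) (Z : M'.Mod)).hom ≫ ·)
        (θ.μ_natural_right X (Y := (Y ⊗ Z : M.Mod)) (θ.μ Y Z))
  oplax_left_unitality X :=
    ((congrArg ((λ_ (X : M'.Mod)).inv ≫ ·)
        (θ.μ_natural_left (Y := 𝟙_ M.Mod) θ.ε X).symm).trans <|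
      Functor.LaxMonoidal.left_unitality_inv (M.idFunctor M') X).symm
  oplax_right_unitality X :=
    ((congrArg ((ρ_ (X : M'.Mod)).inv ≫ ·)
        (θ.μ_natural_right X (Y := 𝟙_ M.Mod) θ.ε).symm).trans <|
      Functor.LaxMonoidal.right_unitality_inv (M.idFunctor M') X).symm
  ε_η := θ.η_ε
  η_ε := θ.ε_η
  μ_δ V W := θ.δ_μ V W
  δ_μ V W := θ.μ_δ V W

variable {θ θ'} in
@[simp]
theorem refl_mapZ (z : M.Z) : (refl M).mapZ z = z := by
  change 𝟙 (𝟙_ M.Mod) ≫ z ≫ 𝟙 (𝟙_ M.Mod) = z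
  rw [Category.id_comp]
  exact Category.comp_id _

theorem symm_mapZ_mapZ (z : M.Z) : θ.symm.mapZ (θ.mapZ z) = z := by
  change θ.η ≫ (θ.ε ≫ (M.idFunctor M').map z ≫ θ.η) ≫ θ.ε = z
  rw [Category.assoc, Category.assoc, θ.η_ε, ← Category.assoc, θ.η_ε, Category.comp_id,
    Category.id_comp]
  rfl

theorem mapZ_symm_mapZ (z : M'.Z) : θ.mapZ (θ.symm.mapZ z) = z :=
  θ.symm.symm_mapZ_mapZ z

theorem trans_mapZ (z : M.Z) : (θ.trans θ').mapZ z = θ'.mapZ (θ.mapZ z) := by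
  let _ : (M.idFunctor M').Monoidal := θ
  let _ : (M'.idFunctor M'').Monoidal := θ'
  change (θ'.ε ≫ (M'.idFunctor M'').map θ.ε) ≫
    (M'.idFunctor M'').map ((M.idFunctor M').map z) ≫ (M'.idFunctor M'').map θ.η ≫ θ'.η =
    θ'.ε ≫ (M'.idFunctor M'').map (θ.ε ≫ (M.idFunctor M').map z ≫ θ.η) ≫ θ'.η
  simp only [Functor.map_comp, Category.assoc]

end Iso
end MonStr

namespace BialgebroidStr

variable {A : Type u} [Ring A]

/-- Two bialgebroid structures are identified if there is an isomorphism `f` of the base rings,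
compatible with source and target, and an isomorphism of the monoidal structures compatible with
`R ≅ R'` and with the maps `V ⊗_R W ≅ V ⊗_{R'} W`, `v ⊗ w ↦ v ⊗ w`. -/
def Equivalent (B B' : BialgebroidStr A) : Prop :=
  ∃ (f : B.R ≃+* B'.R) (θ : MonStr.Iso B.toMonStr B'.toMonStr),
    (∀ r, B'.s (f r) = B.s r) ∧ (∀ r, B'.t (op (f r)) = B.t (op r)) ∧
    (∀ r, MonStr.ap θ.unitHom (B'.unitEl (f r)) = MonStr.idEl B'.toMonStr (B.unitEl r)) ∧
    ∀ (V W : B.Mod) (v : B.El V) (w : B.El W),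
      MonStr.ap (θ.tensorHom V W) (B'.tmul (MonStr.idEl _ v) (MonStr.idEl _ w)) =
        MonStr.idEl B'.toMonStr (B.tmul v w)

theorem Equivalent.refl (B : BialgebroidStr A) : B.Equivalent B :=
  ⟨RingEquiv.refl _, MonStr.Iso.refl _, fun _ => rfl, fun _ => rfl, fun _ => rfl,
    fun _ _ _ _ => rfl⟩

theorem Equivalent.symm {B B' : BialgebroidStr A} : B.Equivalent B' → B'.Equivalent B := by
  rintro ⟨f, θ, hs, ht, h1, h2⟩
  refine ⟨f.symm, θ.symm, fun r => ?_, fun r => ?_, fun r => ?_, fun V W v w => ?_⟩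
  · rw [← hs, f.apply_symm_apply]
  · rw [← ht, f.apply_symm_apply]
  · have h := congrArg (MonStr.ap θ.η) (h1 (f.symm r))
    rw [f.apply_symm_apply] at h
    have e : MonStr.ap θ.η (MonStr.ap θ.unitHom (B'.unitEl r)) = B'.unitEl r :=
      congrArg (MonStr.ap · (B'.unitEl r)) θ.ε_η
    exact h.symm.trans e
  · have h := congrArg (MonStr.ap (θ.δ V W)) (h2 V W v w)
    have e : MonStr.ap (θ.δ V W) (MonStr.ap (θ.tensorHom V W) (B'.tmul v w)) = B'.tmul v w :=
      congrArg (MonStr.ap · (B'.tmul v w)) (θ.μ_δ V W)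
    exact h.symm.trans e

theorem Equivalent.trans {B B' B'' : BialgebroidStr A} :
    B.Equivalent B' → B'.Equivalent B'' → B.Equivalent B'' := by
  rintro ⟨f, θ, hs, ht, h1, h2⟩ ⟨f', θ', hs', ht', h1', h2'⟩
  refine ⟨f.trans f', θ.trans θ', fun r => (hs' _).trans (hs _), fun r => (ht' _).trans (ht _),
    fun r => ?_, fun V W v w => ?_⟩
  · exact (congrArg (MonStr.ap ((B'.toMonStr.idFunctor B''.toMonStr).map θ.ε)) (h1' (f r))).trans
      (h1 r)
  · exact (congrArg (MonStr.ap ((B'.toMonStr.idFunctor B''.toMonStr).map (θ.μ V W)))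
      (h2' V W v w)).trans (h2 V W v w)

variable (A) in
/-- Bialgebroid structures up to isomorphism of the base. -/
def setoid : Setoid (BialgebroidStr A) :=
  ⟨Equivalent, Equivalent.refl, Equivalent.symm, Equivalent.trans⟩

end BialgebroidStr

namespace CategoricalData

variable {A : Type u} [Ring A]

/-- Two categorical data are identified if there is an isomorphism of the monoidal structures that
is compatible with `ζ` and `μ`. -/
def Equivalent (D D' : CategoricalData A) : Prop :=
  ∃ θ : MonStr.Iso D.toMonStr D'.toMonStr,
    (∀ z, MonStr.ap θ.unitHom (D'.L.zeta (θ.mapZ z)) = MonStr.idEl D'.toMonStr (D.L.zeta z)) ∧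
    ∀ (V W : D.Mod) (v : D.El V) (w : D.El W),
      MonStr.ap (θ.tensorHom V W) (D'.L.mu (MonStr.idEl _ v) (MonStr.idEl _ w)) =
        MonStr.idEl D'.toMonStr (D.L.mu v w)

theorem Equivalent.refl (D : CategoricalData A) : D.Equivalent D :=
  ⟨MonStr.Iso.refl _, fun z => congrArg D.L.zeta (MonStr.Iso.refl_mapZ z),
    fun _ _ _ _ => rfl⟩

theorem Equivalent.symm {D D' : CategoricalData A} : D.Equivalent D' → D'.Equivalent D := by
  rintro ⟨θ, h1, h2⟩
  refine ⟨θ.symm, fun z => ?_, fun V W v w => ?_⟩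
  · have h := congrArg (MonStr.ap θ.η) (h1 (θ.symm.mapZ z))
    rw [θ.mapZ_symm_mapZ] at h
    have e : MonStr.ap θ.η (MonStr.ap θ.unitHom (D'.L.zeta z)) = D'.L.zeta z :=
      congrArg (MonStr.ap · (D'.L.zeta z)) θ.ε_η
    exact h.symm.trans e
  · have h := congrArg (MonStr.ap (θ.δ V W)) (h2 V W v w)
    have e : MonStr.ap (θ.δ V W) (MonStr.ap (θ.tensorHom V W) (D'.L.mu v w)) = D'.L.mu v w :=
      congrArg (MonStr.ap · (D'.L.mu v w)) (θ.μ_δ V W)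
    exact h.symm.trans e

theorem Equivalent.trans {D D' D'' : CategoricalData A} :
    D.Equivalent D' → D'.Equivalent D'' → D.Equivalent D'' := by
  rintro ⟨θ, h1, h2⟩ ⟨θ', h1', h2'⟩
  refine ⟨θ.trans θ', fun z => ?_, fun V W v w => ?_⟩
  · rw [MonStr.Iso.trans_mapZ]
    exact (congrArg (MonStr.ap ((D'.toMonStr.idFunctor D''.toMonStr).map θ.ε))
      (h1' (θ.mapZ z))).trans (h1 z)
  · exact (congrArg (MonStr.ap ((D'.toMonStr.idFunctor D''.toMonStr).map (θ.μ V W)))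
      (h2' V W v w)).trans (h2 V W v w)

variable (A) in
/-- Categorical data up to isomorphism. -/
def setoid : Setoid (CategoricalData A) :=
  ⟨Equivalent, Equivalent.refl, Equivalent.symm, Equivalent.trans⟩

end CategoricalData

namespace MonStr

variable {A : Type u} [Ring A] {M M' : MonStr A}

theorem ap_smul {V W : M.Mod} (f : V ⟶ W) (a : Aᵐᵒᵖ) (v : M.El V) : ap f (a • v) = a • ap f v :=
  (M.toModuleCat.map f).hom.map_smul a v

theorem ap_inv_hom {V W : M.Mod} (i : V ≅ W) (v : M.El V) : ap i.inv (ap i.hom v) = v :=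
  congrArg (ap · v) i.hom_inv_id

variable (M) in
/-- The regular right `A`-module. -/
def regular : M.Mod := ModuleCat.of Aᵐᵒᵖ Aᵐᵒᵖ

variable (M) in
/-- An element of the ring, as an element of the regular module. -/
def regularEl (a : Aᵐᵒᵖ) : M.El M.regular := a

/-- An element of the regular module, as an element of the ring. -/
def scalar (x : M.El M.regular) : Aᵐᵒᵖ := x

/-- The `A`-linear map `a ↦ v a`. -/
def ofEl {V : M.Mod} (v : M.El V) : M.regular ⟶ V :=
  ModuleCat.ofHom (Y := M.El V) (LinearMap.toSpanSingleton Aᵐᵒᵖ (M.El V) v)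

@[simp]
theorem ap_ofEl {V : M.Mod} (v : M.El V) (a : Aᵐᵒᵖ) : ap (ofEl v) (M.regularEl a) = a • v := rfl

variable (M) in
/-- Associative and unital biadditive maps `V × W → V ⊗ W`, natural in the right `A`-modules `V`
and `W`. -/
structure Pairing where
  mu (V W : M.Mod) : M.El V →+ M.El W →+ M.El (V ⊗ W)
  one : M.El (𝟙_ M.Mod)
  mu_left {V V' : M.Mod} (f : V ⟶ V') (W : M.Mod) (v : M.El V) (w : M.El W) :
    ap (f ▷ W) (mu V W v w) = mu V' W (ap f v) w
  mu_right (V : M.Mod) {W W' : M.Mod} (g : W ⟶ W') (v : M.El V) (w : M.El W) :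
    ap (V ◁ g) (mu V W v w) = mu V W' v (ap g w)
  assoc (V W X : M.Mod) (v : M.El V) (w : M.El W) (x : M.El X) :
    ap (α_ V W X).hom (mu _ _ (mu _ _ v w) x) = mu _ _ v (mu _ _ w x)
  one_mu (V : M.Mod) (v : M.El V) : ap (λ_ V).hom (mu _ _ one v) = v
  mu_one (V : M.Mod) (v : M.El V) : ap (ρ_ V).hom (mu _ _ v one) = v

namespace Pairing

variable (P : M.Pairing)

/-- The product `U × V → U ⊗ V ≅ V`. -/
def lact (V : M.Mod) : M.El (𝟙_ M.Mod) →+ M.El V →+ M.El V :=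
  (P.mu (𝟙_ M.Mod) V).compr₂ (ap (λ_ V).hom)

/-- The product `V × U → V ⊗ U ≅ V`. -/
def ract (V : M.Mod) : M.El V →+ M.El (𝟙_ M.Mod) →+ M.El V :=
  (P.mu V (𝟙_ M.Mod)).compr₂ (ap (ρ_ V).hom)

variable {P}

theorem lact_apply {V : M.Mod} (r : M.El (𝟙_ M.Mod)) (v : M.El V) :
    P.lact V r v = ap (λ_ V).hom (P.mu _ _ r v) := rfl

theorem ract_apply {V : M.Mod} (v : M.El V) (r : M.El (𝟙_ M.Mod)) :
    P.ract V v r = ap (ρ_ V).hom (P.mu _ _ v r) := rfl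

@[simp]
theorem lact_one {V : M.Mod} (v : M.El V) : P.lact V P.one v = v := P.one_mu V v

@[simp]
theorem ract_one {V : M.Mod} (v : M.El V) : P.ract V v P.one = v := P.mu_one V v

theorem ract_unit (r r' : M.El (𝟙_ M.Mod)) : P.ract _ r r' = P.lact _ r r' := by
  rw [ract_apply, lact_apply, unitors_equal]

theorem ap_lact {V W : M.Mod} (f : V ⟶ W) (r : M.El (𝟙_ M.Mod)) (v : M.El V) :
    ap f (P.lact V r v) = P.lact W r (ap f v) := by
  rw [lact_apply, lact_apply, ← P.mu_right, ← ap_comp, ← ap_comp, leftUnitor_naturality]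

theorem ap_ract {V W : M.Mod} (f : V ⟶ W) (r : M.El (𝟙_ M.Mod)) (v : M.El V) :
    ap f (P.ract V v r) = P.ract W (ap f v) r := by
  rw [ract_apply, ract_apply, ← P.mu_left, ← ap_comp, ← ap_comp, rightUnitor_naturality]

theorem lact_mu {V W : M.Mod} (r : M.El (𝟙_ M.Mod)) (v : M.El V) (w : M.El W) :
    P.lact _ r (P.mu V W v w) = P.mu V W (P.lact V r v) w := by
  rw [lact_apply, lact_apply, ← P.assoc, ← P.mu_left, ← ap_comp, leftUnitor_tensor_hom,
    Iso.hom_inv_id_assoc]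

theorem mu_ract {V W : M.Mod} (r : M.El (𝟙_ M.Mod)) (v : M.El V) (w : M.El W) :
    P.ract _ (P.mu V W v w) r = P.mu V W v (P.ract W w r) := by
  rw [ract_apply, ract_apply, ← P.mu_right, ← P.assoc, ← ap_comp, rightUnitor_tensor_hom]

theorem ract_mu {V W : M.Mod} (r : M.El (𝟙_ M.Mod)) (v : M.El V) (w : M.El W) :
    P.mu V W (P.ract V v r) w = P.mu V W v (P.lact W r w) := by
  rw [lact_apply, ract_apply, ← P.mu_right, ← P.assoc, ← P.mu_left, ← ap_comp, triangle]

theorem lact_lact {V : M.Mod} (r r' : M.El (𝟙_ M.Mod)) (v : M.El V) :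
    P.lact V (P.lact _ r r') v = P.lact V r (P.lact V r' v) := by
  rw [lact_apply (r := P.lact _ r r'), ← lact_mu, ap_lact, ← lact_apply]

theorem ract_ract {V : M.Mod} (r r' : M.El (𝟙_ M.Mod)) (v : M.El V) :
    P.ract V v (P.lact _ r r') = P.ract V (P.ract V v r) r' := by
  rw [ract_apply (r := P.lact _ r r'), ← ract_unit, ← mu_ract, ap_ract, ← ract_apply]

theorem lact_ract {V : M.Mod} (r r' : M.El (𝟙_ M.Mod)) (v : M.El V) :
    P.ract V (P.lact V r v) r' = P.lact V r (P.ract V v r') := by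
  rw [lact_apply, ← ap_ract, mu_ract, ← lact_apply]

theorem lact_eq_smul {V : M.Mod} (r : M.El (𝟙_ M.Mod)) (v : M.El V) :
    P.lact V r v = scalar (P.lact M.regular r (M.regularEl 1)) • v := by
  have h := ap_lact (P := P) (ofEl v) r (M.regularEl 1)
  rw [ap_ofEl, one_smul] at h
  exact h.symm

theorem ract_eq_smul {V : M.Mod} (r : M.El (𝟙_ M.Mod)) (v : M.El V) :
    P.ract V v r = scalar (P.ract M.regular (M.regularEl 1) r) • v := by
  have h := ap_ract (P := P) (ofEl v) r (M.regularEl 1)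
  rw [ap_ofEl, one_smul] at h
  exact h.symm

theorem leftEnd_eq_lact {V : M.Mod} (z : M.Z) (v : M.El V) :
    ap (M.leftEnd z V) v = P.lact V (ap (V := 𝟙_ M.Mod) (W := 𝟙_ M.Mod) z P.one) v := by
  have h : ap (λ_ V).inv v = P.mu _ _ P.one v := by
    rw [← P.one_mu V v, ap_inv_hom, P.one_mu]
  rw [leftEnd, ap_comp, ap_comp, h, P.mu_left]; rfl

theorem rightEnd_eq_ract {V : M.Mod} (z : M.Z) (v : M.El V) :
    ap (M.rightEnd z V) v = P.ract V v (ap (V := 𝟙_ M.Mod) (W := 𝟙_ M.Mod) z P.one) := by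
  have h : ap (ρ_ V).inv v = P.mu _ _ v P.one := by
    rw [← P.mu_one V v, ap_inv_hom, P.mu_one]
  rw [rightEnd, ap_comp, ap_comp, h, P.mu_right]; rfl

variable (P)

/-- The unit object `U`, as a ring with the multiplication `U × U → U ⊗ U ≅ U`. -/
def Base (_ : M.Pairing) : Type u := M.El (𝟙_ M.Mod)

instance : AddCommGroup P.Base := inferInstanceAs (AddCommGroup (M.El (𝟙_ M.Mod)))

instance : Ring P.Base :=
  { (inferInstance : AddCommGroup P.Base) with
    mul := fun r r' => P.lact _ r r'
    one := P.one
    mul_assoc := fun r r' r'' => lact_lact r r' r''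
    one_mul := fun r => P.one_mu _ r
    mul_one := fun r => (ract_unit r P.one).symm.trans (P.mu_one _ r)
    left_distrib := fun r r' r'' => map_add (P.lact _ r) r' r''
    right_distrib := fun r r' r'' =>
      map_add ((P.lact (𝟙_ M.Mod)).flip r'') r r'
    zero_mul := fun r => map_zero ((P.lact (𝟙_ M.Mod)).flip r)
    mul_zero := fun r => map_zero (P.lact _ r) }

/-- The base ring of a pairing with the source and target maps given by the products of `U` with
the regular module. -/
def sourceTarget : SourceTarget A where
  R := P.Base
  s :=
    { toFun := fun r => unop (scalar (P.ract M.regular (M.regularEl 1) r))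
      map_one' := congrArg unop (ract_one (M.regularEl 1))
      map_mul' := fun r r' => by
        refine congrArg unop ((ract_ract r r' _).trans (ract_eq_smul r' _))
      map_zero' := congrArg unop (map_zero (P.ract M.regular (M.regularEl 1)))
      map_add' := fun r r' => congrArg unop (map_add (P.ract M.regular (M.regularEl 1)) r r') }
  t :=
    { toFun := fun r => unop (scalar (P.lact M.regular r.unop (M.regularEl 1)))
      map_one' := congrArg unop (lact_one (M.regularEl 1))
      map_mul' := fun r r' => by
        refine congrArg unop ((lact_lact r'.unop r.unop _).trans (lact_eq_smul r'.unop _))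
      map_zero' := congrArg unop (map_zero ((P.lact M.regular).flip (M.regularEl 1)))
      map_add' := fun r r' =>
        congrArg unop (map_add ((P.lact M.regular).flip (M.regularEl 1)) r.unop r'.unop) }
  commute r r' := by
    have h := (ract_eq_smul r (P.lact _ r'.unop (M.regularEl 1))).symm.trans
      ((lact_ract r'.unop r (M.regularEl 1)).trans (lact_eq_smul _ _))
    exact (congrArg unop h).symm

theorem sourceTarget_t {V : M.Mod} (r : P.Base) (v : M.El V) :
    op (P.sourceTarget.t (op r)) • v = P.lact V r v := (lact_eq_smul _ _).symm

theorem sourceTarget_s {V : M.Mod} (r : P.Base) (v : M.El V) :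
    op (P.sourceTarget.s r) • v = P.ract V v r := (ract_eq_smul _ _).symm

/-- The maps `V × W → V ⊗ W` are universal among the biadditive maps that are balanced for the
actions of `U`. -/
structure IsUniversal : Prop where
  span (V W : M.Mod) : ∀ x : M.El (V ⊗ W),
    x ∈ AddSubgroup.closure {x | ∃ v w, P.mu V W v w = x}
  exists_desc {V W : M.Mod} {X : Type u} [AddCommGroup X] (f : M.El V →+ M.El W →+ X)
    (h : ∀ v r w, f (P.ract V v r) w = f v (P.lact W r w)) :
    ∃ g : M.El (V ⊗ W) →+ X, ∀ v w, g (P.mu V W v w) = f v w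

end Pairing

namespace Pairing

variable (P : M.Pairing) (θ : Iso M M')

theorem delta_left {V V' : M.Mod} (f : (M.idFunctor M').obj V ⟶ (M.idFunctor M').obj V')
    (W : M.Mod) (v : M.El V) (w : M.El W) :
    ap (f ▷ (M.idFunctor M').obj W) (ap (θ.δ V W) (P.mu V W v w)) =
      ap (θ.δ V' W) (P.mu V' W (ap (M := M') f v) w) :=
  (congrArg (ap (M := M') · (P.mu V W v w)) (θ.δ_natural_left (X := V) (Y := V') f W)).trans
    (congrArg (ap (M := M') (θ.δ V' W)) (P.mu_left (V := V) (V' := V') f W v w))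

theorem delta_right (V : M.Mod) {W W' : M.Mod}
    (g : (M.idFunctor M').obj W ⟶ (M.idFunctor M').obj W') (v : M.El V) (w : M.El W) :
    ap ((M.idFunctor M').obj V ◁ g) (ap (θ.δ V W) (P.mu V W v w)) =
      ap (θ.δ V W') (P.mu V W' v (ap (M := M') g w)) :=
  (congrArg (ap (M := M') · (P.mu V W v w)) (θ.δ_natural_right V (X := W) (Y := W') g)).trans
    (congrArg (ap (M := M') (θ.δ V W')) (P.mu_right V (W := W) (W' := W') g v w))

/-- The pairing transported along an isomorphism of monoidal structures. -/
def transport : M'.Pairing where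
  mu V W := (P.mu V W).compr₂ (ap (M := M') (θ.δ V W))
  one := ap (M := M') θ.η P.one
  mu_left {V V'} f W v w := P.delta_left θ (V := V) (V' := V') f W v w
  mu_right V {W W'} g v w := P.delta_right θ V (W := W) (W' := W') g v w
  assoc V W X v w x := by
    refine (congrArg (ap (M := M') (α_ V W X).hom)
      (P.delta_left θ (V := (V ⊗ W : M.Mod)) (θ.δ V W) X (P.mu V W v w) x)).symm.trans ?_
    refine (congrArg (ap (M := M') · (P.mu _ X (P.mu V W v w) x))
      (θ.oplax_associativity V W X)).trans ?_
    refine (congrArg (fun y => ap (M := M') ((M.idFunctor M').obj V ◁ θ.δ W X)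
      (ap (M := M') (θ.δ V (W ⊗ X : M.Mod)) y)) (P.assoc V W X v w x)).trans ?_
    exact P.delta_right θ V (W := (W ⊗ X : M.Mod)) (θ.δ W X) v (P.mu W X w x)
  one_mu V v := by
    refine (congrArg (ap (M := M') (λ_ V).hom)
      (P.delta_left θ (V := 𝟙_ M.Mod) θ.η V P.one v)).symm.trans ?_
    exact (congrArg (ap (M := M') · (P.mu (𝟙_ M.Mod) V P.one v))
      (Functor.OplaxMonoidal.left_unitality_hom (M.idFunctor M') V)).trans (P.one_mu V v)
  mu_one V v := by
    refine (congrArg (ap (M := M') (ρ_ V).hom)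
      (P.delta_right θ V (W := 𝟙_ M.Mod) θ.η v P.one)).symm.trans ?_
    exact (congrArg (ap (M := M') · (P.mu V (𝟙_ M.Mod) v P.one))
      (Functor.OplaxMonoidal.right_unitality_hom (M.idFunctor M') V)).trans (P.mu_one V v)

theorem transport_lact {V : M.Mod} (r : M.El (𝟙_ M.Mod)) (v : M.El V) :
    (P.transport θ).lact ((M.idFunctor M').obj V) (ap (M := M') θ.η r) v = P.lact V r v :=
  (congrArg (ap (M := M') (λ_ ((M.idFunctor M').obj V)).hom)
      (P.delta_left θ (V := 𝟙_ M.Mod) θ.η V r v)).symm.trans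
    (congrArg (ap (M := M') · (P.mu (𝟙_ M.Mod) V r v))
      (Functor.OplaxMonoidal.left_unitality_hom (M.idFunctor M') V))

theorem transport_ract {V : M.Mod} (v : M.El V) (r : M.El (𝟙_ M.Mod)) :
    (P.transport θ).ract ((M.idFunctor M').obj V) v (ap (M := M') θ.η r) = P.ract V v r :=
  (congrArg (ap (M := M') (ρ_ ((M.idFunctor M').obj V)).hom)
      (P.delta_right θ V (W := 𝟙_ M.Mod) θ.η v r)).symm.trans
    (congrArg (ap (M := M') · (P.mu V (𝟙_ M.Mod) v r))
      (Functor.OplaxMonoidal.right_unitality_hom (M.idFunctor M') V))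

end Pairing

end MonStr

/-! ### Pairings from bialgebroids and categorical data -/

theorem Bimodule.hom_congr {R : Type u} [Ring R] {V W : Bimodule R} {f g : V ⟶ W} (h : f = g)
    (x : V.carrier) : f.hom x = g.hom x := by
  rw [h]

namespace BialgebroidStr

open MonStr

variable {A : Type u} [Ring A] (B : BialgebroidStr A)

/-- The functor to `R`-`R`-bimodules. -/
abbrev forget : B.Mod ⥤ Bimodule B.R := B.forgetR B.toMonStr

theorem ap_tmul_unitEl_left {V : B.Mod} (r : B.R) (v : B.El V) :
    ap (λ_ V).hom (B.tmul (B.unitEl r) v) = op (B.t (op r)) • v :=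
  (Bimodule.hom_congr (B.lax.left_unitality V)
    (Bimodule.tmul (V := Bimodule.regular B.R) (W := B.forget.obj V)
      (Bimodule.regular.of r) v)).symm

theorem ap_tmul_unitEl_right {V : B.Mod} (v : B.El V) (r : B.R) :
    ap (ρ_ V).hom (B.tmul v (B.unitEl r)) = op (B.s r) • v :=
  (Bimodule.hom_congr (B.lax.right_unitality V)
    (Bimodule.tmul (V := B.forget.obj V) (W := Bimodule.regular B.R)
      v (Bimodule.regular.of r))).symm

/-- The canonical maps `V × W → V ⊗_R W = V ⊗ W`. -/
noncomputable def pairing : B.toMonStr.Pairing where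
  mu V W := (Bimodule.tmulHom (B.forget.obj V) (B.forget.obj W)).compr₂ (B.lax.μ V W).hom
  one := B.unitEl 1
  mu_left {V V'} f W v w := (Bimodule.hom_congr (B.lax.μ_natural_left f W)
    (Bimodule.tmul (V := B.forget.obj V) (W := B.forget.obj W) v w)).symm
  mu_right V W W' g v w := (Bimodule.hom_congr (B.lax.μ_natural_right V g)
    (Bimodule.tmul (V := B.forget.obj V) (W := B.forget.obj W) v w)).symm
  assoc V W X v w x := Bimodule.hom_congr (B.lax.associativity V W X)
    (Bimodule.tmul (V := B.forget.obj V ⊗ B.forget.obj W) (W := B.forget.obj X)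
      (Bimodule.tmul (V := B.forget.obj V) (W := B.forget.obj W) v w) x)
  one_mu V v := (B.ap_tmul_unitEl_left 1 v).trans (by simp)
  mu_one V v := (B.ap_tmul_unitEl_right v 1).trans (by simp)

@[simp]
theorem pairing_mu {V W : B.Mod} (v : B.El V) (w : B.El W) :
    B.pairing.mu V W v w = B.tmul v w := rfl

@[simp]
theorem pairing_lact {V : B.Mod} (r : B.R) (v : B.El V) :
    B.pairing.lact V (B.unitEl r) v = op (B.t (op r)) • v := B.ap_tmul_unitEl_left r v

@[simp]
theorem pairing_ract {V : B.Mod} (v : B.El V) (r : B.R) :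
    B.pairing.ract V v (B.unitEl r) = op (B.s r) • v := B.ap_tmul_unitEl_right v r

theorem isIso_mu (V W : B.Mod) : IsIso (B.lax.μ V W) := by
  let _ := B.lax
  rw [B.strict.μ_eq]; infer_instance

theorem isIso_epsilon : IsIso B.lax.ε := by
  let _ := B.lax
  rw [B.strict.ε_eq]; infer_instance

theorem _root_.Bimodule.bijective_of_isIso {R : Type u} [Ring R] {V W : Bimodule R} (f : V ⟶ W)
    [IsIso f] : Function.Bijective f.hom :=
  Function.bijective_iff_has_inverse.2 ⟨(inv f).hom,
    fun x => Bimodule.hom_congr (IsIso.hom_inv_id f) x,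
    fun x => Bimodule.hom_congr (IsIso.inv_hom_id f) x⟩

/-- The isomorphism `R ≅ U` of additive groups. -/
noncomputable def unitEquiv : B.R ≃+ B.El (𝟙_ B.Mod) :=
  haveI := B.isIso_epsilon
  AddEquiv.ofBijective (B.lax.ε.hom : B.R →+ B.El (𝟙_ B.Mod)) (Bimodule.bijective_of_isIso B.lax.ε)

theorem unitEl_mul (r r' : B.R) :
    B.unitEl (r * r') = B.pairing.lact _ (B.unitEl r) (B.unitEl r') := by
  rw [pairing_lact]
  exact B.lax.ε.map_left r (Bimodule.regular.of r')

theorem pairing_isUniversal : B.pairing.IsUniversal where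
  span V W x := by
    have := B.isIso_mu V W
    obtain ⟨y, rfl⟩ := (Bimodule.bijective_of_isIso (B.lax.μ V W)).2 x
    induction y using Bimodule.tensor_induction with
    | zero => rw [map_zero]; exact zero_mem _
    | pure v w => exact AddSubgroup.subset_closure ⟨v, w, rfl⟩
    | add x y hx hy => rw [map_add]; exact add_mem hx hy
  exists_desc {V W X _} f h := by
    have := B.isIso_mu V W
    have hR (v : B.El V) (r : B.R) (w : B.El W) :
        f (op (B.s r) • v) w = f v (op (B.t (op r)) • w) :=
      (congrArg (f · w) (B.pairing_ract v r)).symm.trans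
        ((h v (B.unitEl r) w).trans (congrArg (f v) (B.pairing_lact r w)))
    refine ⟨(Bimodule.liftAdd (V := B.forget.obj V) (W := B.forget.obj W) f hR).comp
      (inv (B.lax.μ V W)).hom, fun v w => ?_⟩
    exact congrArg (Bimodule.liftAdd (V := B.forget.obj V) (W := B.forget.obj W) f hR)
      (Bimodule.hom_congr (IsIso.hom_inv_id (B.lax.μ V W)) (Bimodule.tmul v w))

end BialgebroidStr

namespace MonStr

variable {A : Type u} [Ring A] {M : MonStr A}

/-- The difference of the two arrows `V ⊗_Z (U ⊗_Z W) ⇉ V ⊗_Z W`. -/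
noncomputable abbrev arrowDiff (lax : M.forgetZ.LaxMonoidal) (V W : M.Mod) :
    (M.forgetZ.obj V ⊗ M.forgetZ.obj (𝟙_ M.Mod) ⊗ M.forgetZ.obj W).carrier →+
      (M.forgetZ.obj V ⊗ M.forgetZ.obj W).carrier :=
  (M.forgetZ.obj V ◁ (lax.μ (𝟙_ M.Mod) W ≫ M.forgetZ.map (λ_ W).hom)).hom -
    ((α_ (M.forgetZ.obj V) (M.forgetZ.obj (𝟙_ M.Mod)) (M.forgetZ.obj W)).inv ≫
      (lax.μ V (𝟙_ M.Mod) ≫ M.forgetZ.map (ρ_ V).hom) ▷ M.forgetZ.obj W).hom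

/-- The class of `v ⊗_Z w`. -/
noncomputable abbrev tmulZ {V W : M.Mod} (v : M.El V) (w : M.El W) :
    (M.forgetZ.obj V ⊗ M.forgetZ.obj W).carrier :=
  Bimodule.tmul (V := M.forgetZ.obj V) (W := M.forgetZ.obj W) v w

theorem comp_arrowDiff (lax : M.forgetZ.LaxMonoidal) {V W : M.Mod} {X : Type u} [AddCommGroup X]
    (F : (M.forgetZ.obj V ⊗ M.forgetZ.obj W).carrier →+ X)
    (h : ∀ (v : M.El V) (r : M.El (𝟙_ M.Mod)) (w : M.El W),
      F (tmulZ (ap (ρ_ V).hom ((lax.μ V (𝟙_ M.Mod)).hom (tmulZ v r))) w) =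
        F (tmulZ v (ap (λ_ W).hom ((lax.μ (𝟙_ M.Mod) W).hom (tmulZ r w))))) :
    F.comp (arrowDiff lax V W) = 0 := by
  ext y
  induction y using Bimodule.tensor_induction with
  | zero => rw [map_zero, map_zero]
  | pure v y =>
    induction y using Bimodule.tensor_induction with
    | zero => rw [Bimodule.tmul_zero, map_zero, map_zero]
    | pure r w =>
      rw [AddMonoidHom.comp_apply, AddMonoidHom.sub_apply, map_sub]
      exact sub_eq_zero.2 (h v r w).symm
    | add x y hx hy => rw [Bimodule.tmul_add, map_add, map_add, hx, hy]
  | add x y hx hy => rw [map_add, map_add, hx, hy]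

namespace ExactMonoidalForget

variable (L : M.ExactMonoidalForget)

theorem ap_mu_zeta_left {V : M.Mod} (z : M.Z) (v : M.El V) :
    ap (λ_ V).hom (L.mu (L.zeta z) v) = ap (M.leftEnd z V) v :=
  (Bimodule.hom_congr (L.lax.left_unitality V)
    (Bimodule.tmul (V := Bimodule.regular M.Z) (W := M.forgetZ.obj V)
      (Bimodule.regular.of z) v)).symm

theorem ap_mu_zeta_right {V : M.Mod} (v : M.El V) (z : M.Z) :
    ap (ρ_ V).hom (L.mu v (L.zeta z)) = ap (M.rightEnd z V) v :=
  (Bimodule.hom_congr (L.lax.right_unitality V)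
    (Bimodule.tmul (V := M.forgetZ.obj V) (W := Bimodule.regular M.Z)
      v (Bimodule.regular.of z))).symm

/-- The maps `V × W → V ⊗_Z W → V ⊗ W`. -/
noncomputable def pairing : M.Pairing where
  mu V W := (Bimodule.tmulHom (M.forgetZ.obj V) (M.forgetZ.obj W)).compr₂ (L.lax.μ V W).hom
  one := L.zeta 1
  mu_left {V V'} f W v w := (Bimodule.hom_congr (L.lax.μ_natural_left f W)
    (Bimodule.tmul (V := M.forgetZ.obj V) (W := M.forgetZ.obj W) v w)).symm
  mu_right V W W' g v w := (Bimodule.hom_congr (L.lax.μ_natural_right V g)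
    (Bimodule.tmul (V := M.forgetZ.obj V) (W := M.forgetZ.obj W) v w)).symm
  assoc V W X v w x := Bimodule.hom_congr (L.lax.associativity V W X)
    (Bimodule.tmul (V := M.forgetZ.obj V ⊗ M.forgetZ.obj W) (W := M.forgetZ.obj X)
      (Bimodule.tmul (V := M.forgetZ.obj V) (W := M.forgetZ.obj W) v w) x)
  one_mu V v := (L.ap_mu_zeta_left 1 v).trans (by rw [leftEnd_one, ap_id])
  mu_one V v := (L.ap_mu_zeta_right v 1).trans (by rw [rightEnd_one, ap_id])

@[simp]
theorem pairing_mu {V W : M.Mod} (v : M.El V) (w : M.El W) :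
    L.pairing.mu V W v w = L.mu v w := rfl

theorem zeta_eq (z : M.Z) : L.zeta z = ap (V := 𝟙_ M.Mod) (W := 𝟙_ M.Mod) z L.pairing.one := by
  have h := L.ap_mu_zeta_right L.pairing.one z
  rw [rightEnd_unit] at h
  rw [← h, ← pairing_mu, ← Pairing.ract_apply, Pairing.ract_unit, Pairing.lact_one]

theorem pairing_isUniversal : L.pairing.IsUniversal where
  span V W x := by
    obtain ⟨y, rfl⟩ := L.surjective V W x
    induction y using Bimodule.tensor_induction with
    | zero => rw [map_zero]; exact zero_mem _
    | pure v w => exact AddSubgroup.subset_closure ⟨v, w, rfl⟩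
    | add x y hx hy => rw [map_add]; exact add_mem hx hy
  exists_desc {V W X _} f h := by
    have hz (v : M.El V) (z : M.Z) (w : M.El W) :
        f (ap (M.rightEnd z V) v) w = f v (ap (M.leftEnd z W) w) := by
      have e := h v (L.zeta z) w
      rwa [Pairing.ract_apply, Pairing.lact_apply, pairing_mu, pairing_mu, ap_mu_zeta_left,
        ap_mu_zeta_right] at e
    let F := Bimodule.liftAdd (V := M.forgetZ.obj V) (W := M.forgetZ.obj W) f hz
    have hker : (L.lax.μ V W).hom.ker ≤ F.ker := fun x hx => by
      obtain ⟨y, rfl⟩ := (L.exact V W x).1 hx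
      exact DFunLike.congr_fun (comp_arrowDiff L.lax F h) y
    refine ⟨AddMonoidHom.liftOfSurjective _ (L.surjective V W) ⟨F, hker⟩, fun v w => ?_⟩
    exact AddMonoidHom.liftOfRightInverse_comp_apply (L.lax.μ V W).hom _ _ ⟨F, hker⟩
      (Bimodule.tmul v w)

end ExactMonoidalForget

namespace Pairing

variable (P : M.Pairing)

/-- The bimodule map `V ⊗_Z W → V ⊗ W`. -/
noncomputable def muZ (V W : M.Mod) : M.forgetZ.obj V ⊗ M.forgetZ.obj W ⟶ M.forgetZ.obj (V ⊗ W) :=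
  Bimodule.lift (V := M.forgetZ.obj V) (W := M.forgetZ.obj W) (X := M.forgetZ.obj (V ⊗ W))
    (P.mu V W)
    (fun (v : M.El V) (z : M.Z) (w : M.El W) => by
      change P.mu V W (ap (M.rightEnd z V) v) w = P.mu V W v (ap (M.leftEnd z W) w)
      rw [leftEnd_eq_lact (P := P), rightEnd_eq_ract (P := P), ract_mu])
    (fun (z : M.Z) (v : M.El V) (w : M.El W) => by
      change P.mu V W (ap (M.leftEnd z V) v) w = ap (M.leftEnd z (V ⊗ W)) (P.mu V W v w)
      rw [leftEnd_eq_lact (P := P), leftEnd_eq_lact (P := P), lact_mu])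
    (fun z (v : M.El V) (w : M.El W) => by
      change P.mu V W v (ap (M.rightEnd z.unop W) w) =
        ap (M.rightEnd z.unop (V ⊗ W)) (P.mu V W v w)
      rw [rightEnd_eq_ract (P := P), rightEnd_eq_ract (P := P), mu_ract])

theorem _root_.MonStr.leftEnd_unit (z : M.Z) : M.leftEnd z (𝟙_ M.Mod) = z := by
  rw [leftEnd, unitors_equal, rightUnitor_naturality, unitors_inv_equal, Iso.inv_hom_id_assoc]

/-- The bimodule map `Z → U`, `z ↦ z(1)`. -/
def zetaZ : 𝟙_ (Bimodule M.Z) ⟶ M.forgetZ.obj (𝟙_ M.Mod) where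
  hom := (AddMonoidHom.mk' (fun z : M.Z => ap (V := 𝟙_ M.Mod) (W := 𝟙_ M.Mod) z P.one)
    (fun _ _ => rfl) : M.Z →+ M.El (𝟙_ M.Mod))
  map_left (z z' : M.Z) := by
    change ap (V := 𝟙_ M.Mod) (W := 𝟙_ M.Mod) z (ap (V := 𝟙_ M.Mod) (W := 𝟙_ M.Mod) z' P.one) =
      ap (M.leftEnd z (𝟙_ M.Mod)) (ap (V := 𝟙_ M.Mod) (W := 𝟙_ M.Mod) z' P.one)
    rw [leftEnd_unit]
  map_right z (z' : M.Z) := by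
    change ap ((z.unop : 𝟙_ M.Mod ⟶ 𝟙_ M.Mod) ≫ z') P.one =
      ap (M.rightEnd z.unop (𝟙_ M.Mod)) (ap (V := 𝟙_ M.Mod) (W := 𝟙_ M.Mod) z' P.one)
    rw [rightEnd_unit, Z_comp_comm, ap_comp]

/-- The monoidal structure on `φ_Z` given by a pairing. -/
@[reducible]
noncomputable def laxZ : M.forgetZ.LaxMonoidal where
  ε := P.zetaZ
  μ := P.muZ
  μ_natural_left f W := Bimodule.tensor_hom_ext fun v w => (P.mu_left f W v w).symm
  μ_natural_right V g := Bimodule.tensor_hom_ext fun v w => (P.mu_right V g v w).symm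
  associativity V W X := Bimodule.tensor_hom_ext_left fun v w x => P.assoc V W X v w x
  left_unitality V := Bimodule.tensor_hom_ext fun (z : M.Z) (v : M.El V) => leftEnd_eq_lact z v
  right_unitality V := Bimodule.tensor_hom_ext fun (v : M.El V) (z : M.Z) => rightEnd_eq_ract z v

variable {P}

theorem IsUniversal.surjective_of_range (hP : P.IsUniversal) {V W : M.Mod} {X : Type u}
    [AddCommGroup X] (F : X →+ M.El (V ⊗ W)) (h : ∀ v w, ∃ x, F x = P.mu V W v w) :
    Function.Surjective F := fun x => by
  have hx : x ∈ F.range := by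
    refine (AddSubgroup.closure_le _).2 ?_ (hP.span V W x)
    rintro _ ⟨v, w, rfl⟩
    exact h v w
  exact hx

/-- The exact monoidal structure on `φ_Z` given by a universal pairing. -/
noncomputable def IsUniversal.exactMonoidalForget (hP : P.IsUniversal) :
    M.ExactMonoidalForget where
  lax := P.laxZ
  surjective V W := hP.surjective_of_range _ fun v w => ⟨Bimodule.tmul v w, rfl⟩
  exact V W x := by
    change (P.muZ V W).hom x = 0 ↔ x ∈ (arrowDiff P.laxZ V W).range
    constructor
    · intro hx
      let q := QuotientAddGroup.mk' (arrowDiff P.laxZ V W).range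
      have hq (v : M.El V) (r : M.El (𝟙_ M.Mod)) (w : M.El W) :
          q (tmulZ (P.ract V v r) w) = q (tmulZ v (P.lact W r w)) := by
        rw [eq_comm, ← sub_eq_zero, ← map_sub]
        exact (QuotientAddGroup.eq_zero_iff _).2 ⟨Bimodule.tmul
          (V := M.forgetZ.obj V) (W := M.forgetZ.obj (𝟙_ M.Mod) ⊗ M.forgetZ.obj W)
          v (tmulZ r w), rfl⟩
      obtain ⟨g, hg⟩ := hP.exists_desc
        ((Bimodule.tmulHom (M.forgetZ.obj V) (M.forgetZ.obj W)).compr₂ q) hq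
      have e : g.comp ((P.muZ V W).hom : _ →+ M.El (V ⊗ W)) = q := BalTensor.hom_ext hg
      have h : g ((P.muZ V W).hom x) = q x := DFunLike.congr_fun e x
      rw [hx] at h
      exact (QuotientAddGroup.eq_zero_iff x).1 (h.symm.trans (map_zero g))
    · rintro ⟨y, rfl⟩
      exact DFunLike.congr_fun (comp_arrowDiff P.laxZ (P.muZ V W).hom fun v r w => ract_mu r v w) y

variable (P)

/-- The bimodule map `V ⊗_R W → V ⊗ W` for a ring `R` over `U`. -/
noncomputable def muOf (S : SourceTarget A) (u : S.R →+ M.El (𝟙_ M.Mod))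
    (hs : ∀ (V : M.Mod) (v : M.El V) r, P.ract V v (u r) = op (S.s r) • v)
    (ht : ∀ (V : M.Mod) (v : M.El V) r, P.lact V (u r) v = op (S.t (op r)) • v) (V W : M.Mod) :
    (S.forgetR M).obj V ⊗ (S.forgetR M).obj W ⟶ (S.forgetR M).obj (V ⊗ W) :=
  Bimodule.lift (V := (S.forgetR M).obj V) (W := (S.forgetR M).obj W)
    (X := (S.forgetR M).obj (V ⊗ W)) (P.mu V W)
    (fun (v : M.El V) (r : S.R) (w : M.El W) => by
      change P.mu V W (op (S.s r) • v) w = P.mu V W v (op (S.t (op r)) • w)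
      rw [← hs, ← ht, ract_mu])
    (fun (r : S.R) (v : M.El V) (w : M.El W) => by
      change P.mu V W (op (S.t (op r)) • v) w = op (S.t (op r)) • P.mu V W v w
      rw [← ht, ← ht, lact_mu])
    (fun r (v : M.El V) (w : M.El W) => by
      change P.mu V W v (op (S.s r.unop) • w) = op (S.s r.unop) • P.mu V W v w
      rw [← hs, ← hs, mu_ract])

variable (S : SourceTarget A) (u : S.R →+ M.El (𝟙_ M.Mod))

/-- The bimodule map `R → U`. -/
def epsilonOf (h : ∀ r r', u (r * r') = P.lact _ (u r) (u r'))
    (hs : ∀ (V : M.Mod) (v : M.El V) r, P.ract V v (u r) = op (S.s r) • v)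
    (ht : ∀ (V : M.Mod) (v : M.El V) r, P.lact V (u r) v = op (S.t (op r)) • v) :
    𝟙_ (Bimodule S.R) ⟶ (S.forgetR M).obj (𝟙_ M.Mod) where
  hom := u
  map_left (r r' : S.R) := (h r r').trans (ht _ _ r)
  map_right r (r' : S.R) := (h r' r.unop).trans ((ract_unit _ _).symm.trans (hs _ _ r.unop))

/-- The monoidal structure on `φ_R` given by a pairing. -/
@[reducible]
noncomputable def laxOf (h : ∀ r r', u (r * r') = P.lact _ (u r) (u r'))
    (hs : ∀ (V : M.Mod) (v : M.El V) r, P.ract V v (u r) = op (S.s r) • v)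
    (ht : ∀ (V : M.Mod) (v : M.El V) r, P.lact V (u r) v = op (S.t (op r)) • v) :
    (S.forgetR M).LaxMonoidal where
  ε := P.epsilonOf S u h hs ht
  μ := P.muOf S u hs ht
  μ_natural_left f W := Bimodule.tensor_hom_ext fun v w => (P.mu_left f W v w).symm
  μ_natural_right V g := Bimodule.tensor_hom_ext fun v w => (P.mu_right V g v w).symm
  associativity V W X := Bimodule.tensor_hom_ext_left fun v w x => P.assoc V W X v w x
  left_unitality V := Bimodule.tensor_hom_ext fun (r : S.R) (v : M.El V) => (ht V v r).symm
  right_unitality V := Bimodule.tensor_hom_ext fun (v : M.El V) (r : S.R) => (hs V v r).symm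

end Pairing

end MonStr

namespace MonStr

variable {A : Type u} [Ring A] (M : MonStr A)

/-- The identity functor to the monoidal category of right `A`-modules. -/
def ofModuleCat : ModuleCat.{u} Aᵐᵒᵖ ⥤ M.Mod := 𝟭 (ModuleCat.{u} Aᵐᵒᵖ)

instance : M.ofModuleCat.Faithful := inferInstanceAs (𝟭 (ModuleCat.{u} Aᵐᵒᵖ)).Faithful

instance : M.ofModuleCat.Additive := inferInstanceAs (𝟭 (ModuleCat.{u} Aᵐᵒᵖ)).Additive

variable (T : M.Mod → M.Mod → M.Mod) (e : ∀ V W : M.Mod, V ⊗ W ≅ T V W)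

/-- The operations of the monoidal structure with tensor product `T`. -/
@[reducible]
def retensorStruct : MonoidalCategoryStruct (ModuleCat.{u} Aᵐᵒᵖ) where
  tensorObj V W := T V W
  whiskerLeft V _ _ f := (e V _).inv ≫ M.ofModuleCat.obj V ◁ M.ofModuleCat.map f ≫ (e V _).hom
  whiskerRight f W := (e _ W).inv ≫ M.ofModuleCat.map f ▷ M.ofModuleCat.obj W ≫ (e _ W).hom
  tensorHom f g := (e _ _).inv ≫ MonoidalCategoryStruct.tensorHom (C := M.Mod)
    (M.ofModuleCat.map f) (M.ofModuleCat.map g) ≫ (e _ _).hom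
  tensorUnit := 𝟙_ M.Mod
  associator V W X := (((e (T V W) X).symm ≪≫ ((e V W).symm ⊗ᵢ .refl (M.ofModuleCat.obj X))) ≪≫
    α_ (M.ofModuleCat.obj V) (M.ofModuleCat.obj W) (M.ofModuleCat.obj X) ≪≫
      ((.refl (M.ofModuleCat.obj V) ⊗ᵢ e W X) ≪≫ e V (T W X)) : T (T V W) X ≅ T V (T W X))
  leftUnitor V := (((e (𝟙_ M.Mod) V).symm ≪≫ ((CategoryTheory.Iso.refl (𝟙_ M.Mod)).symm ⊗ᵢ .refl
    (M.ofModuleCat.obj V))) ≪≫ λ_ (M.ofModuleCat.obj V) : T (𝟙_ M.Mod) V ≅ V)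
  rightUnitor V := (((e V (𝟙_ M.Mod)).symm ≪≫ (.refl (M.ofModuleCat.obj V) ⊗ᵢ
    (CategoryTheory.Iso.refl (𝟙_ M.Mod)).symm)) ≪≫ ρ_ (M.ofModuleCat.obj V) : T V (𝟙_ M.Mod) ≅ V)

/-- The identity functor as an inducing functor. -/
@[reducible]
def retensorData :
    letI := M.retensorStruct T e
    Monoidal.InducingFunctorData M.ofModuleCat :=
  letI := M.retensorStruct T e
  { μIso := e
    whiskerLeft_eq := fun _ _ _ _ => rfl
    whiskerRight_eq := fun _ _ => rfl
    tensorHom_eq := fun _ _ => rfl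
    εIso := .refl _
    associator_eq := fun _ _ _ => rfl
    leftUnitor_eq := fun _ => rfl
    rightUnitor_eq := fun _ => rfl }

/-- The monoidal structure with the tensor product `V ⊗ W` replaced by the isomorphic `T V W`. -/
def retensor : MonStr A where
  mon :=
    letI := M.retensorStruct T e
    Monoidal.induced M.ofModuleCat (M.retensorData T e)
  preadditive :=
    let _ := M.retensorStruct T e
    let _ := Monoidal.induced M.ofModuleCat (M.retensorData T e)
    monoidalPreadditive_of_faithful M.ofModuleCat

/-- The identity functor is an isomorphism from a monoidal structure to the one with the tensor
product replaced. -/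
@[reducible]
def retensorIso : Iso M (M.retensor T e) :=
  letI := M.retensorStruct T e
  Iso.symm (M := M.retensor T e) (M' := M)
    (Monoidal.fromInducedMonoidal M.ofModuleCat (M.retensorData T e))

end MonStr

theorem Bimodule.exists_eq_eqToHom {R : Type u} [Ring R] {C : Type u} [AddCommGroup C]
    {l : Module R C} {r : Module Rᵐᵒᵖ C} {c : SMulCommClass R Rᵐᵒᵖ C}
    {l' : Module R C} {r' : Module Rᵐᵒᵖ C} {c' : SMulCommClass R Rᵐᵒᵖ C}
    (f : @Bimodule.mk R _ C _ l r c ⟶ @Bimodule.mk R _ C _ l' r' c') (hf : ∀ x : C, f.hom x = x) :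
    ∃ h, f = eqToHom h := by
  obtain rfl : l = l' := Module.ext' _ _ fun a x => by
    have h := f.map_left a x
    rwa [hf, hf] at h
  obtain rfl : r = r' := Module.ext' _ _ fun a x => by
    have h := f.map_right a x
    rwa [hf, hf] at h
  exact ⟨rfl, Bimodule.hom_ext' (AddMonoidHom.ext hf)⟩

namespace MonStr

variable {A : Type u} [Ring A] {M M' : MonStr A}

namespace Pairing

variable {P : M.Pairing} (hP : P.IsUniversal)

theorem muOf_bijective (hP : P.IsUniversal) (V W : M.Mod) :
    Function.Bijective (P.muOf P.sourceTarget (AddMonoidHom.id P.Base)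
      (fun _ v r => (P.sourceTarget_s r v).symm)
      (fun _ v r => (P.sourceTarget_t r v).symm) V W).hom := by
  refine ⟨?_, hP.surjective_of_range _ fun v w => ⟨Bimodule.tmul v w, rfl⟩⟩
  let t := Bimodule.tmulHom ((P.sourceTarget.forgetR M).obj V) ((P.sourceTarget.forgetR M).obj W)
  have ht (v : M.El V) (r : P.Base) (w : M.El W) : t (P.ract V v r) w = t v (P.lact W r w) :=
    (congrArg (t · w) (P.sourceTarget_s r v).symm).trans
      ((Bimodule.smul_tmul (V := (P.sourceTarget.forgetR M).obj V)
        (W := (P.sourceTarget.forgetR M).obj W) v r w).trans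
          (congrArg (t v) (P.sourceTarget_t r w)))
  obtain ⟨g, hg⟩ := hP.exists_desc t ht
  refine Function.LeftInverse.injective (g := g) fun x => ?_
  exact DFunLike.congr_fun (BalTensor.hom_ext (f := g.comp (P.muOf P.sourceTarget
    (AddMonoidHom.id P.Base) (fun _ v r => (P.sourceTarget_s r v).symm)
      (fun _ v r => (P.sourceTarget_t r v).symm) V W).hom) (g := AddMonoidHom.id _) hg) x

/-- The additive isomorphism `V ⊗_R W ≅ V ⊗ W`. -/
noncomputable def tensorEquiv (V W : M.Mod) :
    ((P.sourceTarget.forgetR M).obj V ⊗ (P.sourceTarget.forgetR M).obj W).carrier ≃+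
      M.El (V ⊗ W) :=
  AddEquiv.ofBijective _ (muOf_bijective hP V W)

/-- The right `A`-module `V ⊗_R W`. -/
noncomputable def balancedTensor (V W : M.Mod) : M.Mod :=
  letI := (tensorEquiv hP V W).module Aᵐᵒᵖ
  ModuleCat.of Aᵐᵒᵖ
    ((P.sourceTarget.forgetR M).obj V ⊗ (P.sourceTarget.forgetR M).obj W).carrier

/-- The linear isomorphism `V ⊗ W ≅ V ⊗_R W`. -/
noncomputable def balancedLinearEquiv (V W : M.Mod) :
    M.El (V ⊗ W) ≃ₗ[Aᵐᵒᵖ] M.El (balancedTensor hP V W) :=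
  { (tensorEquiv hP V W).symm with
    map_smul' := fun a x => (congrArg (fun y => (tensorEquiv hP V W).symm (a • y))
      ((tensorEquiv hP V W).apply_symm_apply x)).symm }

/-- The isomorphism `V ⊗ W ≅ V ⊗_R W` of right `A`-modules. -/
noncomputable def balancedTensorIso (V W : M.Mod) : V ⊗ W ≅ balancedTensor hP V W :=
  (balancedLinearEquiv hP V W).toModuleIso

/-- The pairing with values in the modules `V ⊗_R W`. -/
noncomputable abbrev balanced :
    (M.retensor (balancedTensor hP) (balancedTensorIso hP)).Pairing :=
  P.transport (M.retensorIso (balancedTensor hP) (balancedTensorIso hP))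

theorem balanced_mu {V W : M.Mod} (v : M.El V) (w : M.El W) :
    (balanced hP).mu V W v w = Bimodule.tmul (V := (P.sourceTarget.forgetR M).obj V)
      (W := (P.sourceTarget.forgetR M).obj W) v w :=
  (tensorEquiv hP V W).symm_apply_apply (Bimodule.tmul (V := (P.sourceTarget.forgetR M).obj V)
      (W := (P.sourceTarget.forgetR M).obj W) v w)

theorem balanced_mul (r r' : P.Base) : r * r' = (balanced hP).lact _ r r' :=
  (P.transport_lact (M.retensorIso (balancedTensor hP) (balancedTensorIso hP))
    (V := 𝟙_ M.Mod) r r').symm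

theorem balanced_ract (V : M.Mod) (v : M.El V) (r : P.Base) :
    (balanced hP).ract V v r = op (P.sourceTarget.s r) • v :=
  (P.transport_ract (M.retensorIso (balancedTensor hP) (balancedTensorIso hP)) v r).trans
    (P.sourceTarget_s r v).symm

theorem balanced_lact (V : M.Mod) (v : M.El V) (r : P.Base) :
    (balanced hP).lact V r v = op (P.sourceTarget.t (op r)) • v :=
  (P.transport_lact (M.retensorIso (balancedTensor hP) (balancedTensorIso hP)) r v).trans
    (P.sourceTarget_t r v).symm

/-- The monoidal structure on `φ_R` for the base ring of a universal pairing. -/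
@[reducible]
noncomputable def balancedLax : (P.sourceTarget.forgetR
    (M.retensor (balancedTensor hP) (balancedTensorIso hP))).LaxMonoidal :=
  (balanced hP).laxOf P.sourceTarget (AddMonoidHom.id P.Base) (balanced_mul hP)
    (balanced_ract hP) (balanced_lact hP)

theorem balancedLax_strict :
    letI := balancedLax hP
    IsStrictMonoidal (P.sourceTarget.forgetR
      (M.retensor (balancedTensor hP) (balancedTensorIso hP))) := by
  let _ := balancedLax hP
  have hε := Bimodule.exists_eq_eqToHom (balancedLax hP).ε fun _ : P.Base => rfl
  have hμ (V W : M.Mod) := Bimodule.exists_eq_eqToHom ((balancedLax hP).μ V W)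
    (DFunLike.congr_fun (BalTensor.hom_ext (g := AddMonoidHom.id _) (balanced_mu hP)))
  exact
    { unit_eq := hε.1
      tensor_eq := fun V W => (hμ V W).1
      ε_eq := hε.2
      μ_eq := fun V W => (hμ V W).2 }

/-- The bialgebroid structure given by a universal pairing. -/
noncomputable def bialgebroidStr : BialgebroidStr A where
  toSourceTarget := P.sourceTarget
  toMonStr := M.retensor (balancedTensor hP) (balancedTensorIso hP)
  lax := balancedLax hP
  strict := balancedLax_strict hP

end Pairing

/-- The isomorphism `U ≅ U'` of additive groups. -/
def Iso.unitEquiv (θ : Iso M M') : M.El (𝟙_ M.Mod) ≃+ M'.El (𝟙_ M'.Mod) where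
  toFun := ap (M := M') θ.η
  invFun := ap (M := M') θ.ε
  left_inv x := congrArg (ap (M := M') · x) θ.η_ε
  right_inv x := congrArg (ap (M := M') · x) θ.ε_η
  map_add' := map_add (ap (M := M') θ.η)

/-- The isomorphism `V ⊗ W ≅ V ⊗' W` of additive groups. -/
def Iso.tensorEquiv (θ : Iso M M') (V W : M.Mod) :
    M.El (V ⊗ W) ≃+ M'.El ((M.idFunctor M').obj V ⊗ (M.idFunctor M').obj W) where
  toFun := ap (M := M') (θ.δ V W)
  invFun := ap (M := M') (θ.μ V W)
  left_inv x := congrArg (ap (M := M') · x) (θ.δ_μ V W)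
  right_inv x := congrArg (ap (M := M') · x) (θ.μ_δ V W)
  map_add' := map_add (ap (M := M') (θ.δ V W))

theorem Iso.mapZ_apply (θ : Iso M M') (z : M.Z) (x : M.El (𝟙_ M.Mod)) :
    ap (V := 𝟙_ M'.Mod) (W := 𝟙_ M'.Mod) (θ.mapZ z) (θ.unitEquiv x) =
      θ.unitEquiv (ap (V := 𝟙_ M.Mod) (W := 𝟙_ M.Mod) z x) :=
  congrArg (fun y => θ.unitEquiv (ap (V := 𝟙_ M.Mod) (W := 𝟙_ M.Mod) z y))
    (θ.unitEquiv.symm_apply_apply x)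

theorem Iso.mapZ_one (θ : Iso M M') : θ.mapZ 1 = 1 := by
  change θ.ε ≫ (M.idFunctor M').map (𝟙 (𝟙_ M.Mod)) ≫ θ.η = 𝟙 _
  rw [CategoryTheory.Functor.map_id, Category.id_comp, θ.ε_η]

theorem Pairing.ext {P P' : M.Pairing} (h : P.one = P'.one)
    (h' : ∀ (V W : M.Mod) (v : M.El V) (w : M.El W), P.mu V W v w = P'.mu V W v w) : P = P' := by
  have e : P.mu = P'.mu := by
    funext V W
    exact AddMonoidHom.ext fun v => AddMonoidHom.ext fun w => h' V W v w
  cases P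
  cases e
  cases h
  rfl

theorem Pairing.eq_transport_iff {P : M.Pairing} {P' : M'.Pairing} {θ : Iso M M'} :
    P' = P.transport θ ↔ P'.one = θ.unitEquiv P.one ∧ ∀ (V W : M.Mod) (v : M.El V) (w : M.El W),
      P'.mu ((M.idFunctor M').obj V) ((M.idFunctor M').obj W) v w =
        θ.tensorEquiv V W (P.mu V W v w) := by
  constructor
  · rintro rfl
    exact ⟨rfl, fun _ _ _ _ => rfl⟩
  · rintro ⟨h1, h2⟩
    exact Pairing.ext h1 fun V W v w => h2 V W v w

theorem Pairing.IsUniversal.exactMonoidalForget_pairing {P : M.Pairing} (hP : P.IsUniversal) :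
    hP.exactMonoidalForget.pairing = P :=
  Pairing.ext rfl fun _ _ _ _ => rfl

end MonStr

open MonStr

variable {A : Type u} [Ring A]

theorem CategoricalData.equivalent_iff {D D' : CategoricalData A} :
    D.Equivalent D' ↔ ∃ θ : Iso D.toMonStr D'.toMonStr,
      D'.L.pairing = D.L.pairing.transport θ := by
  refine exists_congr fun θ => ?_
  rw [Pairing.eq_transport_iff]
  refine and_congr ⟨fun h => ?_, fun h z => ?_⟩ (forall₄_congr fun V W v w =>
    (θ.tensorEquiv V W).symm_apply_eq)
  · have h1 := h 1
    rw [θ.mapZ_one] at h1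
    exact θ.unitEquiv.symm_apply_eq.1 h1
  · rw [D'.L.zeta_eq, D.L.zeta_eq, h]
    exact θ.unitEquiv.symm_apply_eq.2 (θ.mapZ_apply z _)

namespace BialgebroidStr

theorem pairing_s (B : BialgebroidStr A) (r : B.R) :
    B.s r = unop (scalar (B.pairing.ract B.regular (B.regularEl 1) (B.unitEl r))) := by
  rw [pairing_ract]
  exact congrArg unop (mul_one (op (B.s r))).symm

theorem pairing_t (B : BialgebroidStr A) (r : B.R) :
    B.t (op r) = unop (scalar (B.pairing.lact B.regular (B.unitEl r) (B.regularEl 1))) := by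
  rw [pairing_lact]
  exact congrArg unop (mul_one (op (B.t (op r)))).symm

theorem equivalent_iff {B B' : BialgebroidStr A} :
    B.Equivalent B' ↔ ∃ θ : Iso B.toMonStr B'.toMonStr, B'.pairing = B.pairing.transport θ := by
  constructor
  · rintro ⟨f, θ, -, -, h1, h2⟩
    refine ⟨θ, Pairing.eq_transport_iff.2 ⟨?_, fun V W v w =>
      (θ.tensorEquiv V W).symm_apply_eq.1 (h2 V W v w)⟩⟩
    have h := h1 1
    rw [map_one] at h
    exact θ.unitEquiv.symm_apply_eq.1 h
  · rintro ⟨θ, h⟩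
    let f : B.R ≃+ B'.R := B.unitEquiv.trans (θ.unitEquiv.trans B'.unitEquiv.symm)
    have hf (r : B.R) : B'.unitEl (f r) = θ.unitEquiv (B.unitEl r) :=
      B'.unitEquiv.apply_symm_apply _
    refine ⟨{ f with map_mul' := fun r r' => B'.unitEquiv.injective ?_ }, θ, fun r => ?_,
      fun r => ?_, fun r => θ.unitEquiv.symm_apply_eq.2 (hf r), fun V W v w =>
        (θ.tensorEquiv V W).symm_apply_eq.2 ((Pairing.eq_transport_iff.1 h).2 V W v w)⟩
    · change B'.unitEl (f (r * r')) = B'.unitEl (f r * f r')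
      rw [unitEl_mul, hf, hf, hf, unitEl_mul, h]
      exact (congrArg θ.unitEquiv (B.pairing.transport_lact θ (V := 𝟙_ B.Mod)
        (B.unitEl r) (B.unitEl r')).symm).trans
          (Pairing.ap_lact (P := B.pairing.transport θ) (V := (B.idFunctor B'.toMonStr).obj
            (𝟙_ B.Mod)) θ.η (θ.unitEquiv (B.unitEl r)) (B.unitEl r'))
    · change B'.s (f r) = B.s r
      rw [pairing_s, pairing_s, hf, h]
      exact congrArg (fun x => unop (scalar x))
        (B.pairing.transport_ract θ (B.regularEl 1) (B.unitEl r))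
    · change B'.t (op (f r)) = B.t (op r)
      rw [pairing_t, pairing_t, hf, h]
      exact congrArg (fun x => unop (scalar x))
        (B.pairing.transport_lact θ (B.unitEl r) (B.regularEl 1))

/-- The categorical datum of a bialgebroid structure. -/
noncomputable def toCategoricalData (B : BialgebroidStr A) : CategoricalData A where
  toMonStr := B.toMonStr
  L := B.pairing_isUniversal.exactMonoidalForget

theorem toCategoricalData_pairing (B : BialgebroidStr A) :
    B.toCategoricalData.L.pairing = B.pairing :=
  B.pairing_isUniversal.exactMonoidalForget_pairing

theorem toCategoricalData_equivalent_iff {B B' : BialgebroidStr A} :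
    B.toCategoricalData.Equivalent B'.toCategoricalData ↔ B.Equivalent B' := by
  rw [CategoricalData.equivalent_iff, equivalent_iff, toCategoricalData_pairing,
    toCategoricalData_pairing]
  exact Iff.rfl

end BialgebroidStr

namespace CategoricalData

/-- The bialgebroid structure of a categorical datum. -/
noncomputable def toBialgebroidStr (D : CategoricalData A) : BialgebroidStr A :=
  Pairing.bialgebroidStr D.L.pairing_isUniversal

theorem equivalent_toCategoricalData (D : CategoricalData A) :
    D.Equivalent D.toBialgebroidStr.toCategoricalData :=
  equivalent_iff.2 ⟨retensorIso _ _ _, rfl⟩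

end CategoricalData

/-- The base ring, source and target of a bialgebroid structure in terms of an isomorphic
categorical datum. -/
theorem CategoricalData.exists_base_equiv (D : CategoricalData A) {B : BialgebroidStr A}
    (θ : Iso B.toMonStr D.toMonStr) (hθ : D.L.pairing = B.pairing.transport θ) :
    ∃ e : B.R ≃+ D.El (𝟙_ D.Mod),
      e 1 = D.L.zeta 1 ∧
      (∀ r r' : B.R, e (r * r') = MonStr.ap (λ_ (𝟙_ D.Mod)).hom (D.L.mu (e r) (e r'))) ∧
      (∀ (V : D.Mod) (v : D.El V) (r : B.R),
        op (B.t (op r)) • v = MonStr.ap (λ_ V).hom (D.L.mu (e r) v)) ∧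
      (∀ (V : D.Mod) (v : D.El V) (r : B.R),
        op (B.s r) • v = MonStr.ap (ρ_ V).hom (D.L.mu v (e r))) := by
  have hl (V : D.Mod) (r : B.R) (v : D.El V) :
      D.L.pairing.lact V (θ.unitEquiv (B.unitEl r)) v = op (B.t (op r)) • v := by
    rw [hθ]
    exact (B.pairing.transport_lact θ (B.unitEl r) v).trans (B.pairing_lact r v)
  have hr (V : D.Mod) (r : B.R) (v : D.El V) :
      D.L.pairing.ract V v (θ.unitEquiv (B.unitEl r)) = op (B.s r) • v := by
    rw [hθ]
    exact (B.pairing.transport_ract θ v (B.unitEl r)).trans (B.pairing_ract v r)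
  refine ⟨B.unitEquiv.trans θ.unitEquiv, (Pairing.eq_transport_iff.1 hθ).1.symm, fun r r' => ?_,
    fun V v r => (hl V r v).symm, fun V v r => (hr V r v).symm⟩
  refine Eq.trans ?_ (hl _ r (θ.unitEquiv (B.unitEl r'))).symm
  refine Eq.trans ?_ (ap_smul (M := D.toMonStr) θ.η (op (B.t (op r))) (B.unitEl r'))
  exact congrArg θ.unitEquiv ((B.unitEl_mul r r').trans (B.pairing_lact r _))

theorem mainTheorem2 (A : Type u) [Ring A] :
    ∃ Φ : Quotient (BialgebroidStr.setoid A) ≃ Quotient (CategoricalData.setoid A),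
      -- the datum attached to a bialgebroid: the same monoidal structure, with
      -- `μ : V ⊗_Z W → V ⊗_R W` canonical and `ζ : Z → R` the inclusion `z ↦ z(1)`
      (∀ B : BialgebroidStr A, ∃ L : B.toMonStr.ExactMonoidalForget,
        (∀ (V W : B.Mod) (v : B.El V) (w : B.El W), L.mu v w = B.tmul v w) ∧
        (∀ z : B.Z, L.zeta z = MonStr.ap (V := 𝟙_ B.Mod) (W := 𝟙_ B.Mod) z (B.unitEl 1)) ∧
        Φ (Quotient.mk _ B) = Quotient.mk _ ⟨B.toMonStr, L⟩) ∧
      -- the base ring, source and target recovered from the categorical datum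
      (∀ (B : BialgebroidStr A) (D : CategoricalData A), Φ (Quotient.mk _ B) = Quotient.mk _ D →
        ∃ e : B.R ≃+ D.El (𝟙_ D.Mod),
          e 1 = D.L.zeta 1 ∧
          (∀ r r' : B.R, e (r * r') = MonStr.ap (λ_ (𝟙_ D.Mod)).hom (D.L.mu (e r) (e r'))) ∧
          (∀ (V : D.Mod) (v : D.El V) (r : B.R),
            op (B.t (op r)) • v = MonStr.ap (λ_ V).hom (D.L.mu (e r) v)) ∧
          (∀ (V : D.Mod) (v : D.El V) (r : B.R),
            op (B.s r) • v = MonStr.ap (ρ_ V).hom (D.L.mu v (e r)))) := by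
  let Φ : Quotient (BialgebroidStr.setoid A) → Quotient (CategoricalData.setoid A) :=
    Quotient.map BialgebroidStr.toCategoricalData fun _ _ h =>
      BialgebroidStr.toCategoricalData_equivalent_iff.2 h
  have hΦ : Function.Bijective Φ := by
    constructor
    · rintro ⟨B⟩ ⟨B'⟩ h
      exact Quotient.sound (BialgebroidStr.toCategoricalData_equivalent_iff.1 (Quotient.exact h))
    · rintro ⟨D⟩
      exact ⟨Quotient.mk _ D.toBialgebroidStr, Quotient.sound D.equivalent_toCategoricalData.symm⟩
  refine ⟨Equiv.ofBijective Φ hΦ, fun B => ⟨B.toCategoricalData.L, fun _ _ _ _ => rfl,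
    fun _ => rfl, rfl⟩, fun B D h => ?_⟩
  obtain ⟨θ, hθ⟩ := CategoricalData.equivalent_iff.1
    (Quotient.exact (s := CategoricalData.setoid A) h)
  rw [BialgebroidStr.toCategoricalData_pairing] at hθ
  exact D.exists_base_equiv θ hθ
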